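/- Let $G$ be a polycyclic group, i.e. a group having a finite series $1=G_0\le G_1\le\dots\le G_m=G$ with each $G_{i-1}$ normal in $G_i$ and $G_i/G_{i-1}$ cyclic. Suppose that its abelianization is $G^{ab}\cong\prod_{i=1}^n C_{p^{e_i}}$, where $p$ is an odd prime, $n \ge 0$, $C_m$ denotes the cyclic group of order $m$, and $1\le e_1\le e_2\le\dots\le e_n$ are integers. Set $d=\sum_{i=1}^n (n-i)e_i$. Let $G\otimes G$ be the nonabelian tensor square of $G$, that is, the group generated by the symbols $x\otimes y$ ($x,y\in G$) subject to the relations $xy\otimes z=({}^xy\otimes{}^xz)(x\otimes z)$ and $x\otimes zt=(x\otimes z)({}^zx\otimes{}^zt)$ for all $x,y,z,t\in G$, where ${}^xy=xyx^{-1}$. Let $M(G)=H_2(G,\mathbb{Z})$ be the Schur multiplier of $G$, and, for a polycyclic group $S$, let $h(S)$ be its Hirsch length, i.e. the number of infinite cyclic factors in a series of $S$ as above (this number does not depend on the series). (a) If $G$ is finite, then $G\otimes G$ and $M(G)$ are finite and $|G\otimes G|=p^d\,|G|\,|M(G)|$. (b) If $G$ is infinite, then $G\otimes G$ and $M(G)$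 are polycyclic and $h(G\otimes G)-h(G)=h(M(G))$. -/

import Mathlib

universe u

/-- Defining relators of the nonabelian tensor square of `G`, as words in the symbols `(x, y)`
(standing for `x ⊗ y`), where `G` acts on itself by conjugation `ˣy = x * y * x⁻¹`. -/
inductive IsTensorRelator (G : Type u) [Group G] : FreeGroup (G × G) → Prop
  /-- `xy ⊗ z = (ˣy ⊗ ˣz) (x ⊗ z)` -/
  | mul_left (x y z : G) : IsTensorRelator G
      (FreeGroup.of (x * y, z) *
        (FreeGroup.of (x * y * x⁻¹, x * z * x⁻¹) * FreeGroup.of (x, z))⁻¹)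
  /-- `x ⊗ zt = (x ⊗ z) (ᶻx ⊗ ᶻt)` -/
  | mul_right (x z t : G) : IsTensorRelator G
      (FreeGroup.of (x, z * t) *
        (FreeGroup.of (x, z) * FreeGroup.of (z * x * z⁻¹, z * t * z⁻¹))⁻¹)

/-- The nonabelian tensor square `G ⊗ G` of a group `G`. -/
abbrev NonabelianTensorSquare (G : Type u) [Group G] : Type u :=
  PresentedGroup {r : FreeGroup (G × G) | IsTensorRelator G r}

/-- The Schur multiplier `M(G) = H₂(G, ℤ)`, the second integral homology group of `G`, written
multiplicatively. (The coefficients `ℤ` are lifted to the universe of `G`.) -/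
noncomputable abbrev SchurMultiplier (G : Type u) [Group G] : Type u :=
  Multiplicative (groupHomology (Rep.trivial (ULift.{u} ℤ) G (ULift.{u} ℤ)) 2)

/-- A polycyclic series of `G`: a finite series of subgroups from `⊥` to `⊤`, each normal in the
next one with cyclic quotient. -/
structure PolycyclicSeries (G : Type u) [Group G] where
  /-- the number of factors of the series -/
  length : ℕ
  /-- the terms of the series -/
  term : Fin (length + 1) → Subgroup G
  term_zero : term 0 = ⊥
  term_last : term (Fin.last length) = ⊤
  le_succ : ∀ i : Fin length, term i.castSucc ≤ term i.succ
  normal : ∀ i : Fin length, ((term i.castSucc).subgroupOf (term i.succ)).Normal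
  cyclic : ∀ i : Fin length,
    IsCyclic (↥(term i.succ) ⧸ (term i.castSucc).subgroupOf (term i.succ))

/-- The `i`-th factor of a polycyclic series. -/
abbrev PolycyclicSeries.factor {G : Type u} [Group G] (s : PolycyclicSeries G)
    (i : Fin s.length) : Type u :=
  ↥(s.term i.succ) ⧸ (s.term i.castSucc).subgroupOf (s.term i.succ)

/-- The number of infinite (hence infinite cyclic) factors of a polycyclic series. -/
noncomputable def PolycyclicSeries.infiniteFactors {G : Type u} [Group G]
    (s : PolycyclicSeries G) : ℕ :=
  Nat.card {i : Fin s.length // Infinite (s.factor i)}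

/-- A group is polycyclic if it has a polycyclic series. -/
def IsPolycyclic (G : Type u) [Group G] : Prop :=
  Nonempty (PolycyclicSeries G)

/-- The Hirsch length `h(G)` of a polycyclic group `G`: the number of infinite cyclic factors in a
polycyclic series. All polycyclic series of `G` have the same number of infinite factors, so taking
the least such number is only a way to pick it out. -/
noncomputable def hirschLength (G : Type u) [Group G] : ℕ :=
  sInf (Set.range fun s : PolycyclicSeries G => s.infiniteFactors)

/-! The commutator map `comm : x ⊗ y ↦ [x, y]` maps `G ⊗ G` onto `G'`, and its kernel is central.
This kernel contains the subgroup `∇(G)` generated by the elements `x ⊗ x`, and Miller's theorem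
identifies `ker comm / ∇(G)` with `M(G)` (`exists_ker_comm_hom`). So `G ⊗ G` has three layers,
`∇(G)`, `M(G)` and `G'`, and everything reduces to comparing `∇(G)` with `G^ab`.

The map `x ↦ x ⊗ x` is quadratic with polar form `(x ⊗ y)(y ⊗ x)`, and depends only on the class of
`x` in `G^ab`. As `p` is odd, `∇(G)` is the direct product over `i ≤ j` of cyclic groups of order `p
^ e i` (`card_nabla`), so `|∇(G)| = p^d |G^ab|`. Together with `|G| = |G^ab| |G'|` this is the
finite case. In general `∇(G)` and `G^ab` are finite, hence invisible to the Hirsch length, and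
additivity gives `h(G ⊗ G) = h(M(G)) + h(G') = h(M(G)) + h(G)`.

For Miller's theorem, let `U` be the central extension of `G` by 2-chains modulo boundaries, with
the tautological cocycle `(g, h) ↦ [g|h]`. Commutators of lifts define a map from `G ⊗ G` onto `U'`
that kills `∇(G)`, and the elements of `U'` over `1` are exactly the 2-cycles modulo boundaries. To
see that nothing more is killed, a central extension of `G` is built in which `(G ⊗ G)/∇(G)` embeds
as the commutator subgroup (`CommutatorCover`); `U` maps to it over `G`.

The same cover gives finiteness and polycyclicity: Schur's theorem on groups with finitely many
commutators applies if `G` is finite, and otherwise the kernel of a finitely generated central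
extension of a polycyclic group is finitely generated (`HasHirsch.fg_inf_ker`). -/

namespace NonabelianTensorSquare

/-! ### The tensor square as a crossed module over `G` -/

variable {G : Type u} [Group G]

/-- The symbol `x ⊗ y`. -/
def tmul (x y : G) : NonabelianTensorSquare G := PresentedGroup.of (x, y)

theorem mul_tmul (x y z : G) :
    tmul (x * y) z = tmul (x * y * x⁻¹) (x * z * x⁻¹) * tmul x z := by
  have h := PresentedGroup.one_of_mem (rels := {r : FreeGroup (G × G) | IsTensorRelator G r})
    (IsTensorRelator.mul_left x y z)
  rw [map_mul, map_inv, map_mul, mul_inv_eq_one] at h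
  exact h

theorem tmul_mul (x z t : G) :
    tmul x (z * t) = tmul x z * tmul (z * x * z⁻¹) (z * t * z⁻¹) := by
  have h := PresentedGroup.one_of_mem (rels := {r : FreeGroup (G × G) | IsTensorRelator G r})
    (IsTensorRelator.mul_right x z t)
  rw [map_mul, map_inv, map_mul, mul_inv_eq_one] at h
  exact h

/-- The homomorphism out of `G ⊗ G` given by a function compatible with the defining relations. -/
def lift {H : Type*} [Group H] (f : G → G → H)
    (h₁ : ∀ x y z, f (x * y) z = f (x * y * x⁻¹) (x * z * x⁻¹) * f x z)
    (h₂ : ∀ x z t, f x (z * t) = f x z * f (z * x * z⁻¹) (z * t * z⁻¹)) :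
    NonabelianTensorSquare G →* H :=
  PresentedGroup.toGroup (f := fun q : G × G => f q.1 q.2) (by
    rintro r (⟨x, y, z⟩ | ⟨x, z, t⟩)
    · simp only [map_mul, map_inv, FreeGroup.lift_apply_of, mul_inv_eq_one]
      exact h₁ x y z
    · simp only [map_mul, map_inv, FreeGroup.lift_apply_of, mul_inv_eq_one]
      exact h₂ x z t)

@[simp]
theorem lift_tmul {H : Type*} [Group H] (f : G → G → H) (h₁ h₂) (x y : G) :
    lift f h₁ h₂ (tmul x y) = f x y :=
  PresentedGroup.toGroup.of _

theorem closure_tmul :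
    Subgroup.closure (Set.range fun q : G × G => tmul q.1 q.2) = ⊤ :=
  PresentedGroup.closure_range_of _

@[elab_as_elim]
theorem induction {P : NonabelianTensorSquare G → Prop} (one : P 1)
    (tmul : ∀ x y, P (tmul x y)) (mul : ∀ s t, P s → P t → P (s * t))
    (inv : ∀ s, P s → P s⁻¹) (t : NonabelianTensorSquare G) : P t := by
  have ht : t ∈ Subgroup.closure
      (Set.range fun q : G × G => NonabelianTensorSquare.tmul q.1 q.2) := by
    rw [closure_tmul]; trivial
  induction ht using Subgroup.closure_induction with
  | mem x hx => obtain ⟨q, rfl⟩ := hx; exact tmul _ _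
  | one => exact one
  | mul x y _ _ hx hy => exact mul x y hx hy
  | inv x _ hx => exact inv x hx

theorem hom_ext {H : Type*} [Group H] {f g : NonabelianTensorSquare G →* H}
    (h : ∀ x y, f (tmul x y) = g (tmul x y)) : f = g :=
  PresentedGroup.ext fun q => h q.1 q.2

/-- The commutator map `x ⊗ y ↦ [x, y]`. -/
def comm : NonabelianTensorSquare G →* G :=
  lift (fun x y => x * y * x⁻¹ * y⁻¹) (fun x y z => by group) (fun x z t => by group)

@[simp]
theorem comm_tmul (x y : G) : comm (tmul x y) = x * y * x⁻¹ * y⁻¹ := by simp [comm]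

/-- The conjugation action of `G` on `G ⊗ G`. -/
def act (g : G) : NonabelianTensorSquare G →* NonabelianTensorSquare G :=
  lift (fun x y => tmul (g * x * g⁻¹) (g * y * g⁻¹))
    (fun x y z => by
      have := mul_tmul (g * x * g⁻¹) (g * y * g⁻¹) (g * z * g⁻¹)
      convert this using 2 <;> [skip; congr 1] <;> group)
    (fun x z t => by
      have := tmul_mul (g * x * g⁻¹) (g * z * g⁻¹) (g * t * g⁻¹)
      convert this using 2 <;> [skip; congr 1] <;> group)

@[simp]
theorem act_tmul (g x y : G) : act g (tmul x y) = tmul (g * x * g⁻¹) (g * y * g⁻¹) := by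
  simp [act]

theorem act_act (g h : G) (t : NonabelianTensorSquare G) : act g (act h t) = act (g * h) t := by
  have : (act g).comp (act h) = act (g * h) := hom_ext fun x y => by
    simp only [MonoidHom.comp_apply, act_tmul]; congr 1 <;> group
  exact DFunLike.congr_fun this t

@[simp]
theorem act_one (t : NonabelianTensorSquare G) : act (1 : G) t = t := by
  have : act (1 : G) = MonoidHom.id _ := hom_ext fun x y => by simp
  exact DFunLike.congr_fun this t

theorem act_act_inv (g : G) (t : NonabelianTensorSquare G) : act g (act g⁻¹ t) = t := by
  rw [act_act, mul_inv_cancel, act_one]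

theorem mul_tmul' (x y z : G) : tmul (x * y) z = act x (tmul y z) * tmul x z := by
  rw [mul_tmul, act_tmul]

theorem tmul_mul' (x z t : G) : tmul x (z * t) = tmul x z * act z (tmul x t) := by
  rw [tmul_mul, act_tmul]

@[simp]
theorem one_tmul (z : G) : tmul 1 z = 1 := by
  have := mul_tmul' 1 1 z
  rw [act_one, mul_one, left_eq_mul] at this
  exact this

@[simp]
theorem tmul_one (z : G) : tmul z 1 = 1 := by
  have := tmul_mul' z 1 1
  rw [act_one, mul_one, left_eq_mul] at this
  exact this

theorem act_inv_tmul (x y : G) : act x (tmul x⁻¹ y) = (tmul x y)⁻¹ := by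
  rw [eq_inv_iff_mul_eq_one, ← mul_tmul', mul_inv_cancel, one_tmul]

theorem act_tmul_inv (x y : G) : act y (tmul x y⁻¹) = (tmul x y)⁻¹ := by
  apply eq_inv_of_mul_eq_one_right
  rw [← tmul_mul', mul_inv_cancel, tmul_one]

/-- Expanding `xx' ⊗ yy'` first on the left or first on the right gives two words that differ only
in their middle factors; cancelling the rest compares the actions of `xy` and `yx`. -/
theorem act_comm_tmul (x y : G) (s : NonabelianTensorSquare G) :
    act (x * y * x⁻¹ * y⁻¹) s = tmul x y * s * (tmul x y)⁻¹ := by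
  have key : ∀ x' y', act (x * y) (tmul x' y') * tmul x y
      = tmul x y * act (y * x) (tmul x' y') := by
    intro x' y'
    have h1 : tmul (x * x') (y * y') =
        act x (tmul x' y) * act (x * y) (tmul x' y') * tmul x y * act y (tmul x y') := by
      rw [mul_tmul', tmul_mul', tmul_mul', map_mul, act_act]
      simp only [mul_assoc]
    have h2 : tmul (x * x') (y * y') =
        act x (tmul x' y) * tmul x y * act (y * x) (tmul x' y') * act y (tmul x y') := by
      rw [tmul_mul', mul_tmul', mul_tmul', map_mul, act_act]
      simp only [mul_assoc]
    rw [h1] at h2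
    have h3 := mul_right_cancel h2
    rw [mul_assoc, mul_assoc] at h3
    exact mul_left_cancel h3
  have key' : ∀ s, act (x * y) s * tmul x y = tmul x y * act (y * x) s := by
    have : (act (x * y) : NonabelianTensorSquare G →* _) =
        (MulAut.conj (tmul x y)).toMonoidHom.comp (act (y * x)) := hom_ext fun a b => by
      simp only [MonoidHom.comp_apply, MulEquiv.coe_toMonoidHom, MulAut.conj_apply]
      rw [← key, mul_inv_cancel_right]
    intro s
    rw [this]
    simp
  have := key' (act (y * x)⁻¹ s)
  rw [act_act_inv, act_act] at this
  rw [← this, mul_inv_cancel_right]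
  congr 2
  group

/-- `G ⊗ G` with its commutator map satisfies the Peiffer identity. -/
theorem act_comm (t s : NonabelianTensorSquare G) : act (comm t) s = t * s * t⁻¹ := by
  induction t using induction generalizing s with
  | one => simp
  | tmul x y => rw [comm_tmul, act_comm_tmul]
  | mul a b ha hb => rw [map_mul, ← act_act, ha, hb]; group
  | inv a ha =>
    have := ha (act (comm a)⁻¹ s)
    rw [act_act_inv] at this
    rw [map_inv]
    generalize act (comm a)⁻¹ s = u at *
    rw [this]
    group

/-- Write `[x, y] = x · (y x⁻¹ y⁻¹)`. The symbol `y x⁻¹ y⁻¹ ⊗ g` comes from expanding `x⁻¹ ⊗ gy`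
according to `gy = y (y⁻¹gy)`, and the action of `xg = [x, g] gx` is known from `act_comm_tmul`. -/
theorem comm_tmul_tmul (x y g : G) :
    tmul (x * y * x⁻¹ * y⁻¹) g = tmul x y * (act g (tmul x y))⁻¹ := by
  have h0 : tmul x⁻¹ (g * y) = tmul x⁻¹ (y * (y⁻¹ * g * y)) := by congr 1; group
  rw [tmul_mul', tmul_mul'] at h0
  have h1 : act y (tmul x⁻¹ (y⁻¹ * g * y)) =
      (tmul x⁻¹ y)⁻¹ * (tmul x⁻¹ g * act g (tmul x⁻¹ y)) := by rw [h0]; group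
  have h2 : act y (tmul x⁻¹ (y⁻¹ * g * y)) = tmul (y * x⁻¹ * y⁻¹) g := by
    rw [act_tmul]; congr 1; group
  have h3 : act (x * g) (tmul x⁻¹ y) = tmul x g * (act g (tmul x y))⁻¹ * (tmul x g)⁻¹ := by
    have : x * g = (x * g * x⁻¹ * g⁻¹) * (g * x) := by group
    rw [this, ← act_act, act_comm_tmul, ← act_act, act_inv_tmul, map_inv]
  calc tmul (x * y * x⁻¹ * y⁻¹) g = tmul (x * (y * x⁻¹ * y⁻¹)) g := by congr 1; group
    _ = _ := by
      rw [mul_tmul', ← h2, h1, map_mul, map_mul, map_inv, act_inv_tmul, act_inv_tmul, act_act, h3]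
      group

/-- The automorphism `x ⊗ y ↦ (y ⊗ x)⁻¹`. -/
def swap : NonabelianTensorSquare G →* NonabelianTensorSquare G :=
  lift (fun x y => (tmul y x)⁻¹)
    (fun x y z => by rw [tmul_mul, mul_inv_rev])
    (fun x z t => by rw [mul_tmul, mul_inv_rev])

@[simp]
theorem swap_tmul (x y : G) : swap (tmul x y) = (tmul y x)⁻¹ := by simp [swap]

theorem swap_act (g : G) (t : NonabelianTensorSquare G) : swap (act g t) = act g (swap t) := by
  have : swap.comp (act g) = (act g).comp swap := hom_ext fun x y => by simp
  exact DFunLike.congr_fun this t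

/-- On symbols this is the mirror image of `comm_tmul_tmul` under `swap`; the Peiffer identity then
extends it to products. It is the main source of the later identities. -/
theorem tmul_comm (g : G) (t : NonabelianTensorSquare G) :
    tmul g (comm t) = act g t * t⁻¹ := by
  have gen : ∀ x y, tmul g (x * y * x⁻¹ * y⁻¹) = act g (tmul x y) * (tmul x y)⁻¹ := by
    intro x y
    have h := congrArg swap (comm_tmul_tmul y x g)
    rw [swap_tmul, map_mul, map_inv, swap_act, swap_tmul, inv_eq_iff_eq_inv, map_inv] at h
    have e : x * y * x⁻¹ * y⁻¹ = (y * x * y⁻¹ * x⁻¹)⁻¹ := by group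
    have h' := act_tmul_inv g (y * x * y⁻¹ * x⁻¹)
    rw [h, inv_inv, inv_inv] at h'
    have h'' := congrArg (act (x * y * x⁻¹ * y⁻¹)) h'
    rw [act_act, e, inv_mul_cancel, act_one, ← e, act_comm_tmul] at h''
    rw [h'']
    group
  induction t using induction with
  | one => simp
  | tmul x y => rw [comm_tmul, gen]
  | mul a b ha hb => rw [map_mul, tmul_mul', act_comm, ha, hb, map_mul]; group
  | inv a ha =>
    have h' := act_tmul_inv g (comm a)
    rw [act_comm, ha] at h'
    rw [map_inv, map_inv]
    have : tmul g (comm a)⁻¹ = a⁻¹ * (act g a * a⁻¹)⁻¹ * a := by rw [← h']; group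
    rw [this]; group

/-- Since `g ⊗ 1 = 1`, the formula `tmul_comm` says that `g` fixes every element of the kernel. -/
theorem act_eq_of_comm_eq_one {t : NonabelianTensorSquare G} (ht : comm t = 1) (g : G) :
    act g t = t := by
  have := tmul_comm g t
  rw [ht, tmul_one] at this
  exact (mul_inv_eq_one.1 this.symm)

theorem ker_comm_le_center : (comm : NonabelianTensorSquare G →* G).ker ≤ Subgroup.center _ := by
  intro t ht
  rw [Subgroup.mem_center_iff]
  intro s
  have := act_comm t s
  rw [MonoidHom.mem_ker.1 ht, act_one, eq_mul_inv_iff_mul_eq] at this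
  exact this

theorem comm_range : (comm : NonabelianTensorSquare G →* G).range = commutator G := by
  apply le_antisymm
  · rintro _ ⟨t, rfl⟩
    induction t using induction with
    | one => simp [one_mem]
    | tmul x y =>
      rw [comm_tmul]
      exact Subgroup.commutator_mem_commutator (Subgroup.mem_top x) (Subgroup.mem_top y)
    | mul a b ha hb => rw [map_mul]; exact mul_mem ha hb
    | inv a ha => rw [map_inv]; exact inv_mem ha
  · rw [commutator_def, Subgroup.commutator_le]
    intro x _ y _
    exact ⟨tmul x y, by simp [commutatorElement_def]⟩

/-! ### The quadratic map `x ↦ x ⊗ x` and the subgroup `∇(G)` -/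

/-- The product `(x ⊗ y) (y ⊗ x)`, an element of the centre. -/
def symm (x y : G) : Subgroup.center (NonabelianTensorSquare G) :=
  ⟨tmul x y * tmul y x, ker_comm_le_center (by
    rw [MonoidHom.mem_ker, map_mul, comm_tmul, comm_tmul]; group)⟩

theorem act_symm (g x y : G) : act g (tmul x y * tmul y x) = tmul x y * tmul y x :=
  act_eq_of_comm_eq_one (by rw [map_mul, comm_tmul, comm_tmul]; group) g

/-- The element `x ⊗ x`, as an element of the centre. -/
def diag (x : G) : Subgroup.center (NonabelianTensorSquare G) :=
  ⟨tmul x x, ker_comm_le_center (by rw [MonoidHom.mem_ker, comm_tmul]; group)⟩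

theorem symm_comm (x y : G) : symm x y = symm y x := by
  have h := Subgroup.mem_center_iff.1 (symm x y).2 (tmul y x)
  change tmul y x * (tmul x y * tmul y x) = tmul x y * tmul y x * tmul y x at h
  rw [← mul_assoc] at h
  exact Subtype.ext (mul_right_cancel h).symm

/-- The products `(x ⊗ z)(z ⊗ x)` are central and fixed by `G`, so the action and the order of the
factors in the expansion do not matter. -/
theorem symm_mul_left (x y z : G) : symm (x * y) z = symm x z * symm y z := by
  apply Subtype.ext
  change tmul (x * y) z * tmul z (x * y) = (tmul x z * tmul z x) * (tmul y z * tmul z y)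
  have h := Subgroup.mem_center_iff.1 (symm x z).2 (act x (tmul y z))
  change act x (tmul y z) * (tmul x z * tmul z x) = tmul x z * tmul z x * act x (tmul y z) at h
  rw [mul_tmul', tmul_mul', ← act_symm x y z, map_mul]
  calc _ = act x (tmul y z) * (tmul x z * tmul z x) * act x (tmul z y) := by group
    _ = _ := by rw [h]; group

theorem symm_mul_right (x y z : G) : symm x (y * z) = symm x y * symm x z := by
  rw [symm_comm, symm_mul_left, symm_comm y, symm_comm z]

theorem diag_mul (x y : G) : diag (x * y) = diag x * diag y * symm x y := by
  apply Subtype.ext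
  change tmul (x * y) (x * y) = tmul x x * tmul y y * (tmul x y * tmul y x)
  have hx := fun t => Subgroup.mem_center_iff.1 (diag x).2 t
  have hy := fun t => Subgroup.mem_center_iff.1 (diag y).2 t
  have ey : act x (tmul y y) = tmul y y :=
    act_eq_of_comm_eq_one (by rw [comm_tmul]; group) x
  change ∀ t, t * tmul x x = tmul x x * t at hx
  change ∀ t, t * tmul y y = tmul y y * t at hy
  rw [mul_tmul', tmul_mul', tmul_mul', map_mul, act_act]
  have h2 : act (x * x) (tmul y y) = tmul y y :=
    act_eq_of_comm_eq_one (by rw [comm_tmul]; group) _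
  rw [h2]
  have hs := congrArg Subtype.val (symm_comm x y)
  change tmul x y * tmul y x = tmul y x * tmul x y at hs
  have h3 : act x (tmul y x) * act x (tmul x y) = tmul y x * tmul x y := by
    rw [← map_mul, act_symm]
  calc act x (tmul y x) * tmul y y * (tmul x x * act x (tmul x y))
      = act x (tmul y x) * (tmul y y * tmul x x) * act x (tmul x y) := by group
    _ = (tmul y y * tmul x x) * (act x (tmul y x) * act x (tmul x y)) := by
      rw [← mul_assoc (act x (tmul y x)), hy, mul_assoc (tmul y y), hx]; group
    _ = _ := by rw [h3, hs, hy]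

/-- By the Peiffer identity `comm t` acts as conjugation by `t`, which fixes `t`. Together with
`diag_mul` this makes `diag` a function on `G^ab`. -/
theorem diag_comm (t : NonabelianTensorSquare G) : diag (comm t) = 1 := by
  apply Subtype.ext
  change tmul (comm t) (comm t) = 1
  rw [tmul_comm, act_comm]
  group

instance : CommGroup (Subgroup.center (NonabelianTensorSquare G)) :=
  { (inferInstance : Group (Subgroup.center (NonabelianTensorSquare G))) with
    mul_comm := fun a b => Subtype.ext (Subgroup.mem_center_iff.1 b.2 a.1) }

/-- The bimultiplicative map `(x, y) ↦ (x ⊗ y) (y ⊗ x)`. -/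
def symmHom : G →* G →* Subgroup.center (NonabelianTensorSquare G) :=
  MonoidHom.mk' (fun x => MonoidHom.mk' (symm x) (symm_mul_right x)) fun x y => by
    ext z : 1
    exact symm_mul_left x y z

variable (G) in
/-- The subgroup `∇(G)` generated by the elements `x ⊗ x`. -/
def nabla : Subgroup (NonabelianTensorSquare G) :=
  Subgroup.closure (Set.range fun x : G => tmul x x)

theorem tmul_self_mem_nabla (x : G) : tmul x x ∈ nabla G :=
  Subgroup.subset_closure ⟨x, rfl⟩

theorem nabla_le_ker_comm : nabla G ≤ comm.ker := by
  rw [nabla, Subgroup.closure_le]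
  rintro _ ⟨x, rfl⟩
  simp [MonoidHom.mem_ker]

theorem nabla_le_center : nabla G ≤ Subgroup.center _ :=
  nabla_le_ker_comm.trans ker_comm_le_center

instance nabla_normal : (nabla G).Normal where
  conj_mem t ht s := by
    rwa [Subgroup.mem_center_iff.1 (nabla_le_center ht), mul_inv_cancel_right]

theorem act_mem_nabla {t : NonabelianTensorSquare G} (ht : t ∈ nabla G) (g : G) :
    act g t ∈ nabla G := by
  rwa [act_eq_of_comm_eq_one (nabla_le_ker_comm ht)]

theorem symm_mem_nabla (x y : G) : tmul x y * tmul y x ∈ nabla G := by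
  have h := congrArg Subtype.val (diag_mul x y)
  change tmul (x * y) (x * y) = tmul x x * tmul y y * (tmul x y * tmul y x) at h
  have h' : tmul x y * tmul y x =
      (tmul x x * tmul y y)⁻¹ * tmul (x * y) (x * y) := by rw [h]; group
  rw [h']
  exact mul_mem (inv_mem (mul_mem (tmul_self_mem_nabla _) (tmul_self_mem_nabla _)))
    (tmul_self_mem_nabla _)

/-- Because `∇(G)` is stable under the action, the elements whose symbol with a fixed element lies
in `∇(G)` form a subgroup, on either side. This makes it possible to adjoin a lift of a single
element to a cover. -/
theorem zpow_tmul_mem_nabla (x : G) (k l : ℤ) : tmul (x ^ k) (x ^ l) ∈ nabla G := by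
  let L (y : G) : Subgroup G :=
    { carrier := {g | tmul g y ∈ nabla G}
      one_mem' := by simp [one_mem]
      mul_mem' := fun {a b} ha hb => by
        simp only [Set.mem_ofPred_eq] at *
        rw [mul_tmul']
        exact mul_mem (act_mem_nabla hb a) ha
      inv_mem' := fun {a} ha => by
        simp only [Set.mem_ofPred_eq] at *
        have := act_mem_nabla (inv_mem ha) a⁻¹
        rwa [← act_inv_tmul, act_act, inv_mul_cancel, act_one] at this }
  let R (x : G) : Subgroup G :=
    { carrier := {g | tmul x g ∈ nabla G}
      one_mem' := by simp [one_mem]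
      mul_mem' := fun {a b} ha hb => by
        simp only [Set.mem_ofPred_eq] at *
        rw [tmul_mul']
        exact mul_mem ha (act_mem_nabla hb a)
      inv_mem' := fun {a} ha => by
        simp only [Set.mem_ofPred_eq] at *
        have := act_mem_nabla (inv_mem ha) a⁻¹
        rwa [← act_tmul_inv, act_act, inv_mul_cancel, act_one] at this }
  have h1 : x ∈ L x := tmul_self_mem_nabla x
  have h2 : x ∈ R (x ^ k) := (L x).zpow_mem h1 k
  exact (R (x ^ k)).zpow_mem h2 l

end NonabelianTensorSquare

/-! ### A central extension containing `(G ⊗ G) / ∇(G)` -/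

namespace NonabelianTensorSquare

variable {G : Type u} [Group G]

/-- A group `E` over `G` whose commutators are the images of the symbols `x ⊗ y` under an
embedding of `(G ⊗ G) / ∇(G)` into `E`. -/
structure CommutatorCover (G : Type u) [Group G] where
  /-- the underlying type -/
  carrier : Type u
  /-- the group structure -/
  [group : Group carrier]
  /-- the map from the tensor square -/
  emb : NonabelianTensorSquare G →* carrier
  /-- the map to `G` -/
  proj : carrier →* G
  ker_emb : emb.ker = nabla G
  proj_emb : ∀ t, proj (emb t) = comm t
  commutator_eq : ∀ a b, a * b * a⁻¹ * b⁻¹ = emb (tmul (proj a) (proj b))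

attribute [instance] CommutatorCover.group

namespace CommutatorCover

theorem emb_eq_one (C : CommutatorCover G) {t : NonabelianTensorSquare G} :
    C.emb t = 1 ↔ t ∈ nabla G := by rw [← C.ker_emb, MonoidHom.mem_ker]

theorem conj_emb (C : CommutatorCover G) (a : C.carrier) (t : NonabelianTensorSquare G) :
    a * C.emb t * a⁻¹ = C.emb (act (C.proj a) t) := by
  have h := C.commutator_eq a (C.emb t)
  rw [C.proj_emb, tmul_comm, map_mul, map_inv] at h
  exact mul_right_cancel h

/-- Commutators are determined by projections to `G`, and `g ⊗ 1 = 1`; so a cover is a central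
extension of the image of `proj`. -/
theorem ker_proj_le_center (C : CommutatorCover G) :
    C.proj.ker ≤ Subgroup.center C.carrier := by
  intro a ha
  rw [Subgroup.mem_center_iff]
  intro b
  have h := C.commutator_eq b a
  rw [MonoidHom.mem_ker.1 ha, tmul_one, map_one, mul_inv_eq_one, mul_inv_eq_iff_eq_mul] at h
  exact h

variable (G) in
/-- The cover `(G ⊗ G) / ∇(G)` of the commutator subgroup. -/
def base : CommutatorCover G where
  carrier := NonabelianTensorSquare G ⧸ nabla G
  emb := QuotientGroup.mk' _
  proj := QuotientGroup.lift _ comm nabla_le_ker_comm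
  ker_emb := QuotientGroup.ker_mk' _
  proj_emb _ := rfl
  commutator_eq a b := by
    obtain ⟨s, rfl⟩ := QuotientGroup.mk'_surjective _ a
    obtain ⟨t, rfl⟩ := QuotientGroup.mk'_surjective _ b
    change QuotientGroup.mk' _ (s * t * s⁻¹ * t⁻¹) = QuotientGroup.mk' _ (tmul (comm s) (comm t))
    rw [tmul_comm, act_comm]

/-- The action of `G` on a cover by `e ↦ (g ⊗ π e) e`. -/
def twist (C : CommutatorCover G) (g : G) : C.carrier →* C.carrier :=
  MonoidHom.mk' (fun e => C.emb (tmul g (C.proj e)) * e) fun a b => by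
    rw [map_mul, tmul_mul', map_mul, ← C.conj_emb]
    group

theorem twist_apply (C : CommutatorCover G) (g : G) (e : C.carrier) :
    C.twist g e = C.emb (tmul g (C.proj e)) * e := rfl

theorem proj_twist (C : CommutatorCover G) (g : G) (e : C.carrier) :
    C.proj (C.twist g e) = g * C.proj e * g⁻¹ := by
  rw [twist_apply, map_mul, C.proj_emb, comm_tmul]
  group

/-- Comes from `y h y⁻¹ = [y, h] h`. This identity is what makes `twist` an action of `G`. -/
theorem tmul_conj_mul (x y h : G) :
    tmul x (y * h * y⁻¹) * tmul y h = tmul (x * y) h := by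
  have e : y * h * y⁻¹ = (y * h * y⁻¹ * h⁻¹) * h := by group
  rw [e, tmul_mul', act_comm_tmul, ← comm_tmul, tmul_comm, mul_tmul']
  group

theorem twist_twist (C : CommutatorCover G) (g h : G) (e : C.carrier) :
    C.twist g (C.twist h e) = C.twist (g * h) e := by
  rw [twist_apply, proj_twist, twist_apply, twist_apply, ← mul_assoc, ← map_mul, tmul_conj_mul]

theorem twist_one (C : CommutatorCover G) (e : C.carrier) : C.twist 1 e = e := by
  rw [twist_apply, one_tmul, map_one, one_mul]

/-- The twisting action as a homomorphism to the automorphism group. -/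
def twistAut (C : CommutatorCover G) : G →* MulAut C.carrier :=
  { toFun := fun g =>
      { C.twist g with
        invFun := C.twist g⁻¹
        left_inv := fun e => by
          change C.twist g⁻¹ (C.twist g e) = e
          rw [twist_twist, inv_mul_cancel, twist_one]
        right_inv := fun e => by
          change C.twist g (C.twist g⁻¹ e) = e
          rw [twist_twist, mul_inv_cancel, twist_one] }
    map_one' := MulEquiv.ext C.twist_one
    map_mul' := fun g h => MulEquiv.ext fun e => (C.twist_twist g h e).symm }

theorem twistAut_apply (C : CommutatorCover G) (g : G) (e : C.carrier) :
    C.twistAut g e = C.emb (tmul g (C.proj e)) * e := rfl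

theorem twistAut_emb (C : CommutatorCover G) (g : G) (t : NonabelianTensorSquare G) :
    C.twistAut g (C.emb t) = C.emb (act g t) := by
  rw [twistAut_apply, C.proj_emb, tmul_comm, ← map_mul, inv_mul_cancel_right]

theorem emb_inv_tmul (C : CommutatorCover G) (x y : G) :
    (C.emb (tmul x y))⁻¹ = C.emb (tmul y x) := by
  rw [inv_eq_iff_mul_eq_one, ← map_mul, C.emb_eq_one]
  exact symm_mem_nabla x y

theorem proj_comp_twistAut (C : CommutatorCover G) {N : Type*} [Group N] (ρ : N →* G) (c : N) :
    C.proj.comp (MulEquiv.toMonoidHom ((C.twistAut.comp ρ) c)) =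
      (MulEquiv.toMonoidHom (MulAut.conj (ρ c))).comp C.proj :=
  MonoidHom.ext fun e => C.proj_twist (ρ c) e

open SemidirectProduct in
/-- The cover obtained by adjoining a lift of the element `x` of `G`. -/
def adjoin (C : CommutatorCover G) (x : G) : CommutatorCover G :=
  let ρ : Multiplicative ℤ →* G := zpowersHom G x
  let f : (C.carrier ⋊[C.twistAut.comp ρ] Multiplicative ℤ) →* G :=
    SemidirectProduct.lift C.proj ρ (C.proj_comp_twistAut ρ)
  { carrier := C.carrier ⋊[C.twistAut.comp ρ] Multiplicative ℤ
    emb := inl.comp C.emb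
    proj := f
    ker_emb := by
      rw [← C.ker_emb]
      ext t
      simp only [MonoidHom.mem_ker, MonoidHom.comp_apply]
      exact map_eq_one_iff _ inl_injective
    proj_emb := fun t => by
      rw [MonoidHom.comp_apply, SemidirectProduct.lift_inl, C.proj_emb]
    commutator_eq := by
      have fl : ∀ e, f (inl e) = C.proj e := fun e => SemidirectProduct.lift_inl _ _ _ _
      have fr : ∀ c, f (inr c) = ρ c := fun c => SemidirectProduct.lift_inr _ _ _ _
      have conj : ∀ a t, a * inl (C.emb t) * a⁻¹ = inl (C.emb (act (f a) t)) := by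
        intro a t
        rw [← inl_left_mul_inr_right a]
        have h1 : ∀ c t, inr c * inl (C.emb t) * (inr c)⁻¹ =
            (inl (C.emb (act (ρ c) t)) : C.carrier ⋊[C.twistAut.comp ρ] Multiplicative ℤ) := by
          intro c t
          rw [← C.twistAut_emb, ← map_inv, ← inl_aut]
          rfl
        have h2 : ∀ e t, inl e * inl (C.emb t) * (inl e)⁻¹ =
            (inl (C.emb (act (C.proj e) t)) :
              C.carrier ⋊[C.twistAut.comp ρ] Multiplicative ℤ) := by
          intro e t
          rw [← C.conj_emb, map_mul, map_mul, map_inv]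
        rw [map_mul, fl, fr, ← act_act, ← h2, ← h1]
        group
      -- Both sides of `P` expand in the same way under products in either argument, by `conj`, so
      -- it suffices to check pairs from the two factors of the semidirect product.
      let P (a b : C.carrier ⋊[C.twistAut.comp ρ] Multiplicative ℤ) : Prop :=
        a * b * a⁻¹ * b⁻¹ = inl (C.emb (tmul (f a) (f b)))
      have mulL : ∀ a a' b, P a b → P a' b → P (a * a') b := by
        intro a a' b h h'
        change _ = _
        rw [map_mul, mul_tmul', map_mul, map_mul, ← conj, ← h, ← h']
        group
      have mulR : ∀ a b b', P a b → P a b' → P a (b * b') := by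
        intro a b b' h h'
        change _ = _
        rw [map_mul, tmul_mul', map_mul, map_mul, ← conj, ← h, ← h']
        group
      have ll : ∀ e e', P (inl e) (inl e') := by
        intro e e'
        change _ = _
        rw [fl, fl, ← C.commutator_eq]
        simp only [map_mul, map_inv]
      -- The twisting action was designed for this case: a lift of `g` must conjugate `e` to `(g ⊗ π
      -- e) e`.
      have rl : ∀ c e, P (inr c) (inl e) := by
        intro c e
        change _ = _
        rw [fl, fr, ← map_inv, ← inl_aut, ← map_inv, ← map_mul]
        change inl (C.twistAut (ρ c) e * e⁻¹) = _
        rw [twistAut_apply, mul_inv_cancel_right]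
      have lr : ∀ e c, P (inl e) (inr c) := by
        intro e c
        change _ = _
        have h : _ = _ := rl c e
        rw [fl, fr] at h ⊢
        rw [← C.emb_inv_tmul, map_inv, ← h]
        group
      have rr : ∀ c c', P (inr c) (inr c') := by
        intro c c'
        change _ = _
        rw [fr, fr]
        have : C.emb (tmul (ρ c) (ρ c')) = 1 := by
          rw [C.emb_eq_one]
          exact zpow_tmul_mem_nabla x _ _
        rw [this, ← map_inv, ← map_inv, ← map_mul, ← map_mul, ← map_mul, mul_comm c c']
        simp
      intro a b
      change P a b
      rw [← inl_left_mul_inr_right a, ← inl_left_mul_inr_right b]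
      exact mulL _ _ _ (mulR _ _ _ (ll _ _) (lr _ _)) (mulR _ _ _ (rl _ _) (rr _ _)) }

theorem range_le_adjoin (C : CommutatorCover G) (x : G) :
    C.proj.range ≤ (C.adjoin x).proj.range := by
  rintro _ ⟨e, rfl⟩
  exact ⟨SemidirectProduct.inl e, SemidirectProduct.lift_inl _ _ (C.proj_comp_twistAut _) _⟩

theorem mem_adjoin (C : CommutatorCover G) (x : G) : x ∈ (C.adjoin x).proj.range :=
  ⟨SemidirectProduct.inr (Multiplicative.ofAdd 1), by
    refine (SemidirectProduct.lift_inr _ _ (C.proj_comp_twistAut _) _).trans ?_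
    exact zpow_one x⟩

theorem exists_mem_range (l : List G) :
    ∃ C : CommutatorCover G, commutator G ≤ C.proj.range ∧ ∀ x ∈ l, x ∈ C.proj.range := by
  induction l with
  | nil =>
    refine ⟨base G, ?_, by simp⟩
    rw [← comm_range]
    rintro _ ⟨t, rfl⟩
    exact ⟨QuotientGroup.mk' _ t, rfl⟩
  | cons x l ih =>
    obtain ⟨C, h1, h2⟩ := ih
    refine ⟨C.adjoin x, h1.trans (C.range_le_adjoin x), fun y hy => ?_⟩
    rcases List.mem_cons.1 hy with rfl | hy
    · exact C.mem_adjoin y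
    · exact C.range_le_adjoin x (h2 y hy)

/-- The image of the base cover is already `G'`, so finitely many adjunctions, one for each class in
`G^ab`, suffice. -/
theorem exists_surjective [Finite (Abelianization G)] :
    ∃ C : CommutatorCover G, Function.Surjective C.proj := by
  have := Fintype.ofFinite (Abelianization G)
  obtain ⟨r, hr⟩ : ∃ r : Abelianization G → G, ∀ q, Abelianization.of (r q) = q :=
    ⟨_, Function.surjInv_eq (QuotientGroup.mk'_surjective (commutator G))⟩
  obtain ⟨C, h1, h2⟩ := exists_mem_range
    ((Finset.univ : Finset (Abelianization G)).toList.map r)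
  refine ⟨C, fun g => ?_⟩
  have hx : r (Abelianization.of g) ∈ C.proj.range :=
    h2 _ (List.mem_map.2 ⟨_, Finset.mem_toList.2 (Finset.mem_univ _), rfl⟩)
  have hc : (r (Abelianization.of g))⁻¹ * g ∈ commutator G := by
    rw [← Abelianization.ker_of, MonoidHom.mem_ker, map_mul, map_inv, hr, inv_mul_cancel]
  have := mul_mem hx (h1 hc)
  rwa [mul_inv_cancel_left] at this

theorem emb_range_eq_commutator (C : CommutatorCover G) (hC : Function.Surjective C.proj) :
    C.emb.range = commutator C.carrier := by
  apply le_antisymm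
  · rintro _ ⟨t, rfl⟩
    induction t using NonabelianTensorSquare.induction with
    | one => simp [one_mem]
    | tmul x y =>
      obtain ⟨a, rfl⟩ := hC x
      obtain ⟨b, rfl⟩ := hC y
      rw [← C.commutator_eq]
      exact Subgroup.commutator_mem_commutator (Subgroup.mem_top a) (Subgroup.mem_top b)
    | mul a b ha hb => rw [map_mul]; exact mul_mem ha hb
    | inv a ha => rw [map_inv]; exact inv_mem ha
  · rw [commutator_def, Subgroup.commutator_le]
    intro x _ y _
    exact ⟨_, (C.commutator_eq x y).symm⟩

/-- A commutator in the cover depends only on two elements of `G`, so there are finitely many, and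
by Schur's theorem they generate a finite group. -/
theorem finite_emb_range [Finite G] (C : CommutatorCover G)
    (hC : Function.Surjective C.proj) : Finite C.emb.range := by
  have : Finite (commutatorSet C.carrier) := by
    have : commutatorSet C.carrier ⊆ Set.range fun q : G × G => C.emb (tmul q.1 q.2) := by
      rintro _ ⟨a, b, rfl⟩
      exact ⟨(C.proj a, C.proj b), (C.commutator_eq a b).symm⟩
    exact (Set.finite_range _).subset this
  rw [C.emb_range_eq_commutator hC]
  infer_instance

end CommutatorCover

end NonabelianTensorSquare

/-! ### Central extensions defined by 2-cocycles -/

/-- A 2-cocycle on `G` with values in the abelian group `A`, with trivial action. -/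
structure TwoCocycle (G A : Type*) [Group G] [AddCommGroup A] where
  /-- the underlying function -/
  toFun : G → G → A
  cocycle : ∀ g h k, toFun g h + toFun (g * h) k = toFun h k + toFun g (h * k)

namespace TwoCocycle

variable {G A : Type*} [Group G] [AddCommGroup A] (c : TwoCocycle G A)

theorem one_left (g : G) : c.toFun 1 g = c.toFun 1 1 := by
  have := c.cocycle 1 1 g
  simp only [mul_one, one_mul] at this
  exact (add_left_injective _ (this.trans (add_comm _ _))).symm

theorem one_right (g : G) : c.toFun g 1 = c.toFun 1 1 := by
  have := c.cocycle g 1 1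
  simp only [mul_one] at this
  exact (add_left_injective _ this)

/-- The central extension of `G` by `A` defined by a 2-cocycle. -/
@[ext]
structure Ext (c : TwoCocycle G A) where
  /-- the component in `A` -/
  fst : A
  /-- the component in `G` -/
  snd : G

namespace Ext

variable {c}

instance : Mul c.Ext := ⟨fun x y => ⟨x.fst + y.fst + c.toFun x.snd y.snd, x.snd * y.snd⟩⟩

/-- Cocycles are not assumed normalised, hence the correction by `c(1, 1)`. -/
instance : One c.Ext := ⟨⟨-c.toFun 1 1, 1⟩⟩

instance : Inv c.Ext := ⟨fun x => ⟨-x.fst - c.toFun x.snd⁻¹ x.snd - c.toFun 1 1, x.snd⁻¹⟩⟩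

@[simp] theorem mul_fst (x y : c.Ext) :
    (x * y).fst = x.fst + y.fst + c.toFun x.snd y.snd := rfl
@[simp] theorem mul_snd (x y : c.Ext) : (x * y).snd = x.snd * y.snd := rfl
@[simp] theorem one_fst : (1 : c.Ext).fst = -c.toFun 1 1 := rfl
@[simp] theorem one_snd : (1 : c.Ext).snd = 1 := rfl
@[simp] theorem inv_fst (x : c.Ext) :
    (x⁻¹).fst = -x.fst - c.toFun x.snd⁻¹ x.snd - c.toFun 1 1 := rfl
@[simp] theorem inv_snd (x : c.Ext) : (x⁻¹).snd = x.snd⁻¹ := rfl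

instance : Group c.Ext :=
  Group.ofLeftAxioms
    (fun x y z => by
      ext
      · simp only [mul_fst, mul_snd]
        have := c.cocycle x.snd y.snd z.snd
        calc _ = x.fst + y.fst + z.fst +
            (c.toFun x.snd y.snd + c.toFun (x.snd * y.snd) z.snd) := by abel
          _ = _ := by rw [this]; abel
      · simp [mul_assoc])
    (fun x => by
      ext
      · simp only [mul_fst, one_fst, one_snd, c.one_left]; abel
      · simp)
    (fun x => by
      ext
      · simp only [mul_fst, one_fst, inv_fst, inv_snd]; abel
      · simp)

variable (c) in
/-- The projection of the extension onto `G`. -/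
def proj : c.Ext →* G where
  toFun := snd
  map_one' := rfl
  map_mul' _ _ := rfl

variable (c) in
/-- The set-theoretic section of the projection. -/
def sec (g : G) : c.Ext := ⟨0, g⟩

@[simp] theorem proj_apply (x : c.Ext) : proj c x = x.snd := rfl

theorem ker_proj_le_center : (proj c).ker ≤ Subgroup.center c.Ext := by
  intro x hx
  rw [MonoidHom.mem_ker, proj_apply] at hx
  rw [Subgroup.mem_center_iff]
  intro y
  ext
  · simp only [mul_fst, hx, c.one_left, c.one_right]; abel
  · simp [hx]

/-- The homomorphism to a group `H` determined by a map `A → H` with central values and a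
compatible function on `G`. -/
def lift {H : Type*} [Group H] (f : Multiplicative A →* H) (s : G → H)
    (hf : ∀ a h, f a * h = h * f a)
    (hs : ∀ g h, s g * s h = f (Multiplicative.ofAdd (c.toFun g h)) * s (g * h)) : c.Ext →* H :=
  MonoidHom.mk' (fun x => f (Multiplicative.ofAdd x.fst) * s x.snd) fun x y => by
    simp only [mul_fst, mul_snd, ofAdd_add, map_mul]
    rw [mul_assoc (f _ * f _), ← hs]
    simp only [mul_assoc]
    rw [← mul_assoc (s x.snd) (f _), ← hf]
    simp only [mul_assoc]

theorem lift_apply {H : Type*} [Group H] (f : Multiplicative A →* H) (s : G → H) (hf hs)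
    (x : c.Ext) : lift (c := c) f s hf hs x = f (Multiplicative.ofAdd x.fst) * s x.snd := rfl

end Ext

end TwoCocycle

/-! ### Commutators of lifts in a central extension -/

namespace NonabelianTensorSquare

variable {G : Type u} [Group G]

section CentralExtension

variable {U : Type*} [Group U] (f : U →* G) (hf : f.ker ≤ Subgroup.center U)
include hf

/-- Two lifts of an element differ by a central factor, which cancels in a commutator. -/
theorem commutator_eq_of_map_eq {a a' b b' : U} (ha : f a = f a') (hb : f b = f b') :
    a * b * a⁻¹ * b⁻¹ = a' * b' * a'⁻¹ * b'⁻¹ := by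
  have h1 : ∀ {a a' : U}, f a = f a' → ∃ z, (∀ g, g * z = z * g) ∧ a' = a * z := by
    intro a a' h
    refine ⟨a⁻¹ * a', Subgroup.mem_center_iff.1 (hf ?_), by group⟩
    rw [MonoidHom.mem_ker, map_mul, map_inv, h, inv_mul_cancel]
  obtain ⟨z, hz, rfl⟩ := h1 ha
  obtain ⟨w, hw, rfl⟩ := h1 hb
  have e1 : a * z * (b * w) * (a * z)⁻¹ * (b * w)⁻¹ =
      a * (z * b) * (w * z⁻¹) * a⁻¹ * w⁻¹ * b⁻¹ := by group
  have e2 : w * z⁻¹ = z⁻¹ * w := (hw _).symm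
  have e3 : w * a⁻¹ = a⁻¹ * w := (hw _).symm
  rw [e1, ← hz, e2]
  calc _ = a * b * a⁻¹ * b⁻¹ := by group
    _ = a * b * (a⁻¹ * w) * w⁻¹ * b⁻¹ := by group
    _ = _ := by rw [← e3]; group

/-- The map `x ⊗ y ↦ [x̃, ỹ]` into a central extension of `G`. -/
noncomputable def toCentralExtension (hs : Function.Surjective f) :
    NonabelianTensorSquare G →* U :=
  lift (fun x y => Function.surjInv hs x * Function.surjInv hs y *
      (Function.surjInv hs x)⁻¹ * (Function.surjInv hs y)⁻¹)
    (fun x y z => by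
      have e := Function.surjInv_eq hs
      generalize Function.surjInv hs = s at e ⊢
      have h1 := commutator_eq_of_map_eq f hf (a := s (x * y)) (a' := s x * s y) (b := s z)
        (b' := s z) (by simp [e]) rfl
      have h2 := commutator_eq_of_map_eq f hf (a := s (x * y * x⁻¹)) (a' := s x * s y * (s x)⁻¹)
        (b := s (x * z * x⁻¹)) (b' := s x * s z * (s x)⁻¹) (by simp [e]) (by simp [e])
      rw [h1, h2]
      group)
    (fun x z t => by
      have e := Function.surjInv_eq hs
      generalize Function.surjInv hs = s at e ⊢
      have h1 := commutator_eq_of_map_eq f hf (a := s x) (a' := s x) (b := s (z * t))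
        (b' := s z * s t) rfl (by simp [e])
      have h2 := commutator_eq_of_map_eq f hf (a := s (z * x * z⁻¹)) (a' := s z * s x * (s z)⁻¹)
        (b := s (z * t * z⁻¹)) (b' := s z * s t * (s z)⁻¹) (by simp [e]) (by simp [e])
      rw [h1, h2]
      group)

theorem toCentralExtension_tmul (hs : Function.Surjective f) (a b : U) :
    toCentralExtension f hf hs (tmul (f a) (f b)) = a * b * a⁻¹ * b⁻¹ := by
  rw [toCentralExtension, lift_tmul]
  exact commutator_eq_of_map_eq f hf (Function.surjInv_eq hs _) (Function.surjInv_eq hs _)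

theorem map_toCentralExtension (hs : Function.Surjective f) (t : NonabelianTensorSquare G) :
    f (toCentralExtension f hf hs t) = comm t := by
  have : f.comp (toCentralExtension f hf hs) = comm := hom_ext fun x y => by
    obtain ⟨a, rfl⟩ := hs x
    obtain ⟨b, rfl⟩ := hs y
    rw [MonoidHom.comp_apply, toCentralExtension_tmul, comm_tmul]
    simp
  exact DFunLike.congr_fun this t

theorem nabla_le_ker_toCentralExtension (hs : Function.Surjective f) :
    nabla G ≤ (toCentralExtension f hf hs).ker := by
  rw [nabla, Subgroup.closure_le]
  rintro _ ⟨x, rfl⟩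
  obtain ⟨a, rfl⟩ := hs x
  change toCentralExtension f hf hs (tmul (f a) (f a)) = 1
  rw [toCentralExtension_tmul]
  group

theorem range_toCentralExtension (hs : Function.Surjective f) :
    (toCentralExtension f hf hs).range = commutator U := by
  apply le_antisymm
  · rintro _ ⟨t, rfl⟩
    induction t using NonabelianTensorSquare.induction with
    | one => simp [one_mem]
    | tmul x y =>
      obtain ⟨a, rfl⟩ := hs x
      obtain ⟨b, rfl⟩ := hs y
      rw [toCentralExtension_tmul]
      exact Subgroup.commutator_mem_commutator (Subgroup.mem_top a) (Subgroup.mem_top b)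
    | mul a b ha hb => rw [map_mul]; exact mul_mem ha hb
    | inv a ha => rw [map_inv]; exact inv_mem ha
  · rw [commutator_def, Subgroup.commutator_le]
    intro x _ y _
    exact ⟨_, toCentralExtension_tmul f hf hs x y⟩

end CentralExtension

end NonabelianTensorSquare

/-! ### Low-degree chains and the universal 2-cocycle -/

namespace SchurMultiplier

open groupHomology

section Chains

variable {M : Type*} [AddCommGroup M] {α : Type*}

theorem chain_hom_ext {f g : (α →₀ ULift.{u} ℤ) →+ M}
    (h : ∀ x, f (Finsupp.single x 1) = g (Finsupp.single x 1)) : f = g := by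
  apply Finsupp.addHom_ext'
  intro x
  have : (f.comp (Finsupp.singleAddHom x)).comp (AddEquiv.ulift (α := ℤ)).symm.toAddMonoidHom =
      (g.comp (Finsupp.singleAddHom x)).comp (AddEquiv.ulift (α := ℤ)).symm.toAddMonoidHom :=
    AddMonoidHom.ext_int (h x)
  ext r
  exact DFunLike.congr_fun this r.down

/-- The additive map on integral chains with prescribed values on basis elements. -/
noncomputable def chainLift (m : α → M) : (α →₀ ULift.{u} ℤ) →+ M :=
  Finsupp.liftAddHom fun x =>
    (zmultiplesHom M (m x)).comp (AddEquiv.ulift (α := ℤ)).toAddMonoidHom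

theorem chainLift_single (m : α → M) (x : α) :
    chainLift (M := M) m (Finsupp.single x (1 : ULift.{u} ℤ)) = m x := by
  rw [chainLift, Finsupp.liftAddHom_apply_single]
  change (1 : ULift.{u} ℤ).down • m x = m x
  rw [ULift.one_down, one_smul]

end Chains

variable (G : Type u) [Group G]

/-- The trivial representation of `G` on `ℤ`. -/
noncomputable abbrev coeff : Rep (ULift.{u} ℤ) G := Rep.trivial (ULift.{u} ℤ) G (ULift.{u} ℤ)

/-- The 2-chains of `G` modulo boundaries. -/
abbrev ChainsModBoundaries : Type u :=
  (G × G →₀ (coeff G)) ⧸ boundaries₂ (coeff G)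

/-- The class of a 2-chain modulo boundaries. -/
noncomputable def chainClass : (G × G →₀ ULift.{u} ℤ) →+ ChainsModBoundaries G :=
  (Submodule.mkQ (boundaries₂ (coeff G))).toAddMonoidHom

variable {G} in
theorem chainClass_eq_zero {x : G × G →₀ ULift.{u} ℤ} :
    chainClass G x = 0 ↔ x ∈ boundaries₂ (coeff G) :=
  Submodule.Quotient.mk_eq_zero _

theorem chainClass_surjective : Function.Surjective (chainClass G) :=
  Submodule.mkQ_surjective _

theorem d₃₂_mem_boundaries (q : G × G × G) :
    (d₃₂ (coeff G) (Finsupp.single q (1 : ULift.{u} ℤ))) ∈ boundaries₂ (coeff G) :=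
  ⟨_, rfl⟩

/-- The universal 2-cocycle `(g, h) ↦ [g|h]`. -/
noncomputable def cocycle : TwoCocycle G (ChainsModBoundaries G) where
  toFun g h := chainClass G (Finsupp.single (g, h) 1)
  cocycle g h k := by
    have h1 := d₃₂_mem_boundaries G (g, h, k)
    rw [d₃₂_single] at h1
    have h2 := chainClass_eq_zero.2 h1
    rw [map_sub, map_add, map_sub, Representation.isTrivial_def, LinearMap.id_apply] at h2
    rw [sub_eq_zero] at h2
    rw [← h2]
    abel

end SchurMultiplier

namespace SchurMultiplier

open groupHomology

variable {G : Type u} [Group G]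

theorem d₃₂_single_eq (q : G × G × G) :
    (d₃₂ (coeff G)).hom (Finsupp.single q (1 : ULift.{u} ℤ)) =
      (Finsupp.single (q.2.1, q.2.2) 1 - Finsupp.single (q.1 * q.2.1, q.2.2) 1 +
        Finsupp.single (q.1, q.2.1 * q.2.2) 1 - Finsupp.single (q.1, q.2.1) 1 :
          G × G →₀ ULift.{u} ℤ) :=
  d₃₂_single (A := coeff G) q (1 : ULift.{u} ℤ)

theorem d₂₁_single_eq (q : G × G) :
    (d₂₁ (coeff G)).hom (Finsupp.single q (1 : ULift.{u} ℤ)) =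
      (Finsupp.single q.2 1 - Finsupp.single (q.1 * q.2) 1 + Finsupp.single q.1 1 :
          G →₀ ULift.{u} ℤ) :=
  d₂₁_single (A := coeff G) q (1 : ULift.{u} ℤ)

theorem chainLift_boundary {M : Type*} [AddCommGroup M] (m : TwoCocycle G M)
    {x : G × G →₀ ULift.{u} ℤ} (hx : x ∈ boundaries₂ (coeff G)) :
    chainLift (fun q : G × G => m.toFun q.1 q.2) x = 0 := by
  obtain ⟨y, rfl⟩ := hx
  let F : (G × G × G →₀ ULift.{u} ℤ) →+ M :=
    (chainLift (fun q : G × G => m.toFun q.1 q.2)).comp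
      (d₃₂ (coeff G)).hom.toAddMonoidHom
  have : F = 0 := by
    apply chain_hom_ext
    rintro ⟨g, h, k⟩
    change chainLift _ ((d₃₂ (coeff G)).hom (Finsupp.single (g, h, k) (1 : ULift.{u} ℤ))) = 0
    rw [d₃₂_single_eq, map_sub, map_add, map_sub]
    simp only [chainLift_single]
    have := m.cocycle g h k
    rw [sub_eq_zero, sub_add_eq_add_sub, ← this]
    abel
  exact DFunLike.congr_fun this y

theorem exists_desc {B C D : Type*} [AddCommGroup B] [AddCommGroup C] [AddCommGroup D]
    (f : B →+ C) (hf : Function.Surjective f) (g : B →+ D) (h : ∀ x, f x = 0 → g x = 0) :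
    ∃ k : C →+ D, ∀ x, k (f x) = g x :=
  ⟨f.liftOfSurjective hf ⟨g, fun x hx => h x hx⟩, fun x =>
    f.liftOfRightInverse_comp_apply _ _ ⟨g, fun x hx => h x hx⟩ x⟩

/-- The cocycle identity says exactly that the linear extension to chains vanishes on boundaries;
hence the tautological cocycle is universal. -/
theorem exists_hom_of_cocycle {M : Type*} [AddCommGroup M] (m : TwoCocycle G M) :
    ∃ k : ChainsModBoundaries G →+ M, ∀ g h, k ((cocycle G).toFun g h) = m.toFun g h := by
  obtain ⟨k, hk⟩ := exists_desc (chainClass G) (chainClass_surjective G)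
    (chainLift fun q : G × G => m.toFun q.1 q.2)
    fun x hx => chainLift_boundary m (chainClass_eq_zero.1 hx)
  exact ⟨k, fun g h => (hk _).trans (chainLift_single _ _)⟩

theorem classes_hom_ext {M : Type*} [AddCommGroup M] {k l : ChainsModBoundaries G →+ M}
    (h : ∀ g h, k ((cocycle G).toFun g h) = l ((cocycle G).toFun g h)) : k = l := by
  have : k.comp (chainClass G) = l.comp (chainClass G) := chain_hom_ext fun q => h q.1 q.2
  ext x
  obtain ⟨y, rfl⟩ := chainClass_surjective G x
  exact DFunLike.congr_fun this y

variable (G) in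
/-- The boundary map on 2-chains modulo boundaries, together with the characterisation of
`H₂(G, ℤ)` as its kernel. -/
theorem exists_boundary : ∃ (d : ChainsModBoundaries G →+ (G →₀ ULift.{u} ℤ))
    (ι : groupHomology (coeff G) 2 →+ ChainsModBoundaries G),
    (∀ g h, d ((cocycle G).toFun g h) =
      Finsupp.single h 1 - Finsupp.single (g * h) 1 + Finsupp.single g 1) ∧
    Function.Injective ι ∧ ∀ x, x ∈ ι.range ↔ d x = 0 := by
  obtain ⟨d, hd⟩ := exists_desc (chainClass G) (chainClass_surjective G)
    ((d₂₁ (coeff G)).hom.toAddMonoidHom : (G × G →₀ ULift.{u} ℤ) →+ (G →₀ ULift.{u} ℤ))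
    fun x hx => by
      obtain ⟨y, rfl⟩ := chainClass_eq_zero.1 hx
      exact d₃₂_apply_mem_cycles₂ y
  let Z : cycles₂ (coeff G) →+ groupHomology (coeff G) 2 := (H2π (coeff G)).hom.toAddMonoidHom
  have hZ : Function.Surjective Z := fun x =>
    H2_induction_on (C := fun x => ∃ z, Z z = x) x fun z => ⟨z, rfl⟩
  have hZ0 : ∀ z, Z z = 0 ↔ z.1 ∈ boundaries₂ (coeff G) := fun z => H2π_eq_zero_iff z
  let incl : cycles₂ (coeff G) →+ ChainsModBoundaries G :=
    (chainClass G).comp (cycles₂ (coeff G)).subtype.toAddMonoidHom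
  obtain ⟨ι, hι⟩ := exists_desc Z hZ incl
    fun x hx => chainClass_eq_zero.2 ((hZ0 x).1 hx)
  refine ⟨d, ι, fun g h => (hd _).trans (d₂₁_single_eq (g, h)), ?_, ?_⟩
  · rw [injective_iff_map_eq_zero]
    intro x hx
    obtain ⟨z, rfl⟩ := hZ x
    rw [hι] at hx
    exact (hZ0 z).2 (chainClass_eq_zero.1 hx)
  · intro x
    constructor
    · rintro ⟨y, rfl⟩
      obtain ⟨z, rfl⟩ := hZ y
      rw [hι]
      exact (hd z.1).trans z.2
    · intro hx
      obtain ⟨y, rfl⟩ := chainClass_surjective G x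
      rw [hd] at hx
      exact ⟨Z ⟨y, hx⟩, hι _⟩

end SchurMultiplier

/-! ### Miller's theorem: `ker comm / ∇(G) ≅ M(G)` -/

namespace NonabelianTensorSquare

open SchurMultiplier TwoCocycle

variable {G : Type u} [Group G]

/-- A cover defines a homomorphism from the universal central extension by a free cocycle. -/
theorem exists_hom_cover (C : CommutatorCover G) (hC : Function.Surjective C.proj) :
    ∃ F : (cocycle G).Ext →* C.carrier, ∀ x, C.proj (F x) = x.snd := by
  let s := Function.surjInv hC
  have hs : ∀ g, C.proj (s g) = g := Function.surjInv_eq hC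
  have hz : ∀ g h, s g * s h * (s (g * h))⁻¹ ∈ C.proj.ker := fun g h => by
    simp [MonoidHom.mem_ker, hs]
  have hc : ∀ a ∈ C.proj.ker, ∀ b, b * a = a * b := fun a ha =>
    Subgroup.mem_center_iff.1 (C.ker_proj_le_center ha)
  let _ : CommGroup C.proj.ker :=
    { (inferInstance : Group C.proj.ker) with
      mul_comm := fun a b => Subtype.ext (hc b.1 b.2 a.1) }
  let m : TwoCocycle G (Additive C.proj.ker) :=
    { toFun := fun g h => Additive.ofMul ⟨_, hz g h⟩
      cocycle := fun g h k => by
        apply Additive.toMul.injective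
        apply Subtype.ext
        change s g * s h * (s (g * h))⁻¹ * (s (g * h) * s k * (s (g * h * k))⁻¹) =
          s h * s k * (s (h * k))⁻¹ * (s g * s (h * k) * (s (g * (h * k)))⁻¹)
        have h1 := hc _ (hz h k) (s g)
        calc _ = s g * (s h * s k * (s (h * k))⁻¹) * s (h * k) * (s (g * h * k))⁻¹ := by group
          _ = _ := by rw [h1, mul_assoc g]; group }
  obtain ⟨k, hk⟩ := exists_hom_of_cocycle m
  let φ : Multiplicative (ChainsModBoundaries G) →* C.carrier :=
    C.proj.ker.subtype.comp (AddMonoidHom.toMultiplicativeLeft k)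
  have hφ : ∀ g h, φ (Multiplicative.ofAdd ((cocycle G).toFun g h)) =
      s g * s h * (s (g * h))⁻¹ := fun g h =>
    congrArg (fun z => ((Additive.toMul z : C.proj.ker) : C.carrier)) (hk g h)
  have hφ1 : ∀ a, φ a ∈ C.proj.ker := fun a => (AddMonoidHom.toMultiplicativeLeft k a).2
  refine ⟨Ext.lift φ s (fun a h => (hc _ (hφ1 a) h).symm) fun g h => by rw [hφ]; group,
    fun x => ?_⟩
  rw [Ext.lift_apply, map_mul, hφ1, hs, one_mul]

/-- The abelianization of the universal extension by a cocycle is free on the canonical section: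
an element on which the boundary plus the projection vanishes is a product of commutators. -/
theorem mem_commutator_ext (d : ChainsModBoundaries G →+ (G →₀ ULift.{u} ℤ))
    (hd : ∀ g h, d ((cocycle G).toFun g h) =
      Finsupp.single h 1 - Finsupp.single (g * h) 1 + Finsupp.single g 1)
    (a : ChainsModBoundaries G) (ha : d a = 0) :
    (⟨a - (cocycle G).toFun 1 1, 1⟩ : (cocycle G).Ext) ∈ commutator (cocycle G).Ext := by
  let q : (cocycle G).Ext →* Abelianization (cocycle G).Ext := Abelianization.of
  -- The identity of the extension is `(-c(1, 1), 1)`, so the kernel is embedded by `a ↦ (a - c(1,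
  -- 1), 1)`; the same shift recurs below.
  let incl : ChainsModBoundaries G →+ Additive (Abelianization (cocycle G).Ext) :=
    AddMonoidHom.mk' (fun a => Additive.ofMul (q ⟨a - (cocycle G).toFun 1 1, 1⟩)) fun a b => by
      rw [← ofMul_mul, ← map_mul]
      congr 2
      ext
      · simp only [Ext.mul_fst]
        abel
      · simp
  let ξ : (G →₀ ULift.{u} ℤ) →+ Additive (Abelianization (cocycle G).Ext) :=
    chainLift fun g => Additive.ofMul (q (Ext.sec _ g))
  -- In the abelianization, `[g|h]` becomes the sum of the sections of `g` and `h` minus that of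
  -- `gh`, the image under `ξ` of its boundary.
  have key : incl = ξ.comp d := by
    apply classes_hom_ext
    intro g h
    rw [AddMonoidHom.comp_apply, hd, map_add, map_sub]
    simp only [ξ, chainLift_single]
    rw [sub_add_eq_add_sub, eq_sub_iff_add_eq]
    change Additive.ofMul (q _ * q _) = Additive.ofMul (q _ * q _)
    rw [← map_mul, mul_comm (q _) (q _), ← map_mul]
    congr 2
    ext
    · simp [Ext.sec, TwoCocycle.one_left]
    · simp [Ext.sec]
  have h1 : incl a = 0 := by rw [key, AddMonoidHom.comp_apply, ha, map_zero]
  rw [← Abelianization.ker_of, MonoidHom.mem_ker]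
  exact h1

variable (G) in
/-- Miller's theorem: the kernel of the commutator map on the nonabelian exterior square is the
Schur multiplier. -/
theorem exists_ker_comm_hom [Finite (Abelianization G)] :
    ∃ θ : (comm : NonabelianTensorSquare G →* G).ker →* SchurMultiplier G,
      Function.Surjective θ ∧ ∀ t, θ t = 1 ↔ t.1 ∈ nabla G := by
  obtain ⟨C, hC⟩ := CommutatorCover.exists_surjective (G := G)
  obtain ⟨F, hF⟩ := exists_hom_cover C hC
  obtain ⟨d, ι, hd, hι, hr⟩ := exists_boundary G
  let f := Ext.proj (cocycle G)
  have hf : f.ker ≤ Subgroup.center _ := Ext.ker_proj_le_center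
  have hs : Function.Surjective f := fun g => ⟨Ext.sec _ g, rfl⟩
  let j := toCentralExtension f hf hs
  -- `F ∘ j` and `C.emb` both send a symbol to the commutator of lifts in the cover, and `C.emb` has
  -- kernel `∇(G)`.
  have hj : ∀ t, j t = 1 → t ∈ nabla G := by
    have : F.comp j = C.emb := hom_ext fun x y => by
      obtain ⟨a, rfl⟩ := hs x
      obtain ⟨b, rfl⟩ := hs y
      rw [MonoidHom.comp_apply, toCentralExtension_tmul, map_mul, map_mul, map_mul, map_inv,
        map_inv, C.commutator_eq, hF, hF]
      rfl
    intro t ht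
    rw [← C.emb_eq_one, ← this, MonoidHom.comp_apply, ht, map_one]
  have hcomm : ∀ t, (j t).snd = comm t := map_toCentralExtension f hf hs
  have d11 : d ((cocycle G).toFun 1 1) = Finsupp.single 1 1 := by
    rw [hd, mul_one, sub_add_cancel]
  -- The target is abelian, so this homomorphism kills commutators; over `1` this forces the shifted
  -- chain component to be a cycle.
  let ψ : (cocycle G).Ext →* Multiplicative (G →₀ ULift.{u} ℤ) :=
    MonoidHom.mk' (fun x => Multiplicative.ofAdd (d x.fst + Finsupp.single x.snd 1))
      fun x y => by
        rw [← ofAdd_add]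
        congr 1
        simp only [Ext.mul_fst, Ext.mul_snd, map_add, hd]
        abel
  have hψ : ∀ t, ψ (j t) = 1 := by
    have : ψ.comp j = 1 := hom_ext fun x y => by
      obtain ⟨a, rfl⟩ := hs x
      obtain ⟨b, rfl⟩ := hs y
      rw [MonoidHom.comp_apply, toCentralExtension_tmul]
      simp only [map_mul, map_inv, MonoidHom.one_apply]
      rw [mul_comm (ψ a), mul_inv_cancel_right, mul_inv_cancel]
    exact fun t => DFunLike.congr_fun this t
  let τ : (comm : NonabelianTensorSquare G →* G).ker →*
      Multiplicative (ChainsModBoundaries G) :=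
    MonoidHom.mk' (fun t => Multiplicative.ofAdd ((j t.1).fst + (cocycle G).toFun 1 1))
      fun s t => by
        rw [← ofAdd_add]
        congr 1
        rw [Subgroup.coe_mul, map_mul, Ext.mul_fst, hcomm, hcomm, s.2, t.2]
        abel
  have hτ : ∀ t, τ t ∈ (AddMonoidHom.toMultiplicative ι).range := by
    intro t
    have h1 : d (j t.1).fst + Finsupp.single (j t.1).snd 1 = 0 := hψ t.1
    rw [hcomm, t.2] at h1
    obtain ⟨y, hy⟩ := (hr ((j t.1).fst + (cocycle G).toFun 1 1)).2 (by rw [map_add, d11, h1])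
    exact ⟨Multiplicative.ofAdd y, congrArg Multiplicative.ofAdd hy⟩
  have hι' : Function.Injective (AddMonoidHom.toMultiplicative ι) := hι
  let e := MonoidHom.ofInjective hι'
  refine ⟨e.symm.toMonoidHom.comp (τ.codRestrict _ hτ), ?_, fun t => ?_⟩
  -- A cycle, placed in the kernel of the extension, is a product of commutators, hence in the range
  -- of `j`.
  · intro y
    have hy : d (ι y.toAdd) = 0 := (hr _).1 ⟨_, rfl⟩
    have h1 := mem_commutator_ext d hd _ hy
    rw [← range_toCentralExtension f hf hs] at h1
    obtain ⟨t, ht⟩ := h1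
    have ht' : comm t = 1 := by rw [← hcomm]; exact congrArg Ext.snd ht
    refine ⟨⟨t, ht'⟩, ?_⟩
    change e.symm _ = y
    rw [MulEquiv.symm_apply_eq]
    apply Subtype.ext
    change Multiplicative.ofAdd ((j t).fst + (cocycle G).toFun 1 1) = Multiplicative.ofAdd (ι _)
    rw [show j t = _ from ht]
    congr 1
    exact sub_add_cancel _ _
  · change e.symm _ = 1 ↔ _
    rw [MulEquiv.symm_apply_eq, map_one]
    constructor
    · intro h
      apply hj
      have h1 : (j t.1).fst + (cocycle G).toFun 1 1 = 0 := congrArg (fun z => z.1) h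
      ext
      · rw [Ext.one_fst]; exact eq_neg_of_add_eq_zero_left h1
      · rw [hcomm]; exact t.2
    · intro h
      have h1 : j t.1 = 1 := nabla_le_ker_toCentralExtension f hf hs h
      apply Subtype.ext
      change Multiplicative.ofAdd ((j t.1).fst + (cocycle G).toFun 1 1) = 1
      rw [h1, Ext.one_fst, neg_add_cancel]
      rfl

end NonabelianTensorSquare

/-! ### The order of `∇(G)` -/

namespace NonabelianTensorSquare

variable {G : Type u} [Group G]

theorem symm_eq_one_of_mem_commutator {c : G} (hc : c ∈ commutator G) (x : G) :
    symm c x = 1 := by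
  have : symmHom c = 1 := Abelianization.commutator_subset_ker symmHom hc
  exact DFunLike.congr_fun this x

theorem diag_eq_one_of_mem_commutator {c : G} (hc : c ∈ commutator G) : diag c = 1 := by
  rw [← comm_range] at hc
  obtain ⟨t, rfl⟩ := hc
  exact diag_comm t

theorem diag_pow (x : G) (k : ℕ) : diag (x ^ k) = diag x ^ (k * k) := by
  have hxx : symm x x = diag x * diag x := rfl
  have h : ∀ k : ℕ, symm (x ^ k) x = (diag x * diag x) ^ k := fun k => by
    rw [← hxx]
    change symmHom (x ^ k) x = symmHom x x ^ k
    rw [map_pow, MonoidHom.pow_apply]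
  induction k with
  | zero =>
    rw [pow_zero]
    exact diag_eq_one_of_mem_commutator (one_mem _)
  | succ k ih =>
    rw [pow_succ, diag_mul, ih, h, ← pow_two (diag x), ← pow_mul, ← pow_succ, ← pow_add]
    congr 1
    ring

/-- The quadratic map gives exponent `q²` and its polar form gives `2q`; for odd `q` their gcd is
`q`. This is where oddness of `p` enters. -/
theorem diag_pow_eq_one {x : G} {q : ℕ} (hq : Odd q) (hx : x ^ q ∈ commutator G) :
    diag x ^ q = 1 := by
  have h1 : diag x ^ (q * q) = 1 := by
    rw [← diag_pow, diag_eq_one_of_mem_commutator hx]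
  have h2 : diag x ^ (2 * q) = 1 := by
    have h : symmHom (x ^ q) x = symmHom x x ^ q := by rw [map_pow, MonoidHom.pow_apply]
    rw [pow_mul, pow_two]
    change symmHom x x ^ q = 1
    rw [← h]
    exact symm_eq_one_of_mem_commutator hx x
  have h3 : orderOf (diag x) ∣ Nat.gcd (2 * q) (q * q) :=
    Nat.dvd_gcd (orderOf_dvd_of_pow_eq_one h2) (orderOf_dvd_of_pow_eq_one h1)
  rw [Nat.gcd_mul_right, Nat.Coprime.gcd_eq_one (Nat.coprime_two_left.2 hq), one_mul] at h3
  exact orderOf_dvd_iff_pow_eq_one.1 h3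

theorem symm_pow_eq_one {x : G} {q : ℕ} (hx : x ^ q ∈ commutator G) (y : G) :
    symm x y ^ q = 1 := by
  have h : symmHom (x ^ q) y = symmHom x y ^ q := by rw [map_pow, MonoidHom.pow_apply]
  rw [← symm_eq_one_of_mem_commutator hx y]
  exact h.symm

/-- The elements `x_i ⊗ x_i` and `(x_i ⊗ x_j) (x_j ⊗ x_i)`, `i < j`, generate `∇(G)` when the
`x_i` generate `G` modulo the commutator subgroup. -/
theorem diag_mem_of_generators {ι : Type*} [LinearOrder ι] (x : ι → G)
    (hx : commutator G ⊔ Subgroup.closure (Set.range x) = ⊤)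
    (W : Subgroup (Subgroup.center (NonabelianTensorSquare G)))
    (hd : ∀ i, diag (x i) ∈ W) (hs : ∀ i j, i < j → symm (x i) (x j) ∈ W) (g : G) :
    diag g ∈ W := by
  have top : ∀ L : Subgroup G, commutator G ≤ L → (∀ i, x i ∈ L) → ∀ g, g ∈ L := by
    intro L h1 h2 g
    have : (⊤ : Subgroup G) ≤ L := by
      rw [← hx, sup_le_iff, Subgroup.closure_le]
      exact ⟨h1, by rintro _ ⟨i, rfl⟩; exact h2 i⟩
    exact this (Subgroup.mem_top g)
  have s1 : ∀ i j, symm (x i) (x j) ∈ W := by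
    intro i j
    rcases lt_trichotomy i j with h | rfl | h
    · exact hs i j h
    · exact mul_mem (hd i) (hd i)
    · rw [symm_comm]; exact hs j i h
  have s2 : ∀ i g, symm (x i) g ∈ W := fun i =>
    top (W.comap (symmHom (x i)))
      (fun c hc => by
        change symm (x i) c ∈ W
        rw [symm_comm, symm_eq_one_of_mem_commutator hc]
        exact one_mem _)
      fun j => s1 i j
  have s3 : ∀ h g, symm h g ∈ W := by
    intro h
    refine top (W.comap (symmHom h)) (fun c hc => ?_) fun j => ?_
    · change symm h c ∈ W
      rw [symm_comm, symm_eq_one_of_mem_commutator hc]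
      exact one_mem _
    · change symm h (x j) ∈ W
      rw [symm_comm]
      exact s2 j h
  let L : Subgroup G :=
    { carrier := {g | diag g ∈ W}
      one_mem' := by
        rw [Set.mem_ofPred_eq, diag_eq_one_of_mem_commutator (one_mem _)]
        exact one_mem _
      mul_mem' := fun {a b} ha hb => by
        rw [Set.mem_ofPred_eq] at *
        rw [diag_mul]
        exact mul_mem (mul_mem ha hb) (s3 _ _)
      inv_mem' := fun {a} ha => by
        rw [Set.mem_ofPred_eq] at *
        have h := diag_mul a a⁻¹
        rw [mul_inv_cancel, diag_eq_one_of_mem_commutator (one_mem _)] at h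
        have h' : diag a⁻¹ = (diag a)⁻¹ * (symm a a⁻¹)⁻¹ := by
          rw [eq_comm, ← mul_inv, inv_eq_iff_mul_eq_one, h]
          rw [mul_right_comm]
        rw [h']
        exact mul_mem (inv_mem ha) (inv_mem (s3 _ _)) }
  exact top L (fun c hc => by
    change diag c ∈ W
    rw [diag_eq_one_of_mem_commutator hc]
    exact one_mem _) hd g

/-- The homomorphism on the tensor square induced by a bimultiplicative map. -/
def ofBimul {H : Type*} [CommGroup H] (β : G →* G →* H) : NonabelianTensorSquare G →* H :=
  lift (fun x y => β x y)
    (fun x y z => by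
      simp only [map_mul, map_inv, MonoidHom.mul_apply, MonoidHom.inv_apply]
      simp [mul_comm])
    (fun x y z => by
      simp only [map_mul, map_inv, MonoidHom.mul_apply, MonoidHom.inv_apply]
      simp)

@[simp]
theorem ofBimul_tmul {H : Type*} [CommGroup H] (β : G →* G →* H) (x y : G) :
    ofBimul β (tmul x y) = β x y := lift_tmul _ _ _ _ _

/-- The homomorphism from `ℤ/q` sending `1` to an element of order dividing `q`. -/
def zmodHom {H : Type*} [CommGroup H] (q : ℕ) (w : H) (hw : w ^ q = 1) :
    Multiplicative (ZMod q) →* H :=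
  AddMonoidHom.toMultiplicativeLeft
    (ZMod.lift q ⟨zmultiplesHom (Additive H) (Additive.ofMul w), by
      rw [zmultiplesHom_apply, natCast_zsmul, ← ofMul_pow, hw, ofMul_one]⟩)

theorem zmodHom_one {H : Type*} [CommGroup H] (q : ℕ) (w : H) (hw : w ^ q = 1) :
    zmodHom q w hw (Multiplicative.ofAdd 1) = w := by
  have := ZMod.lift_coe q (A := Additive H) ⟨zmultiplesHom (Additive H) (Additive.ofMul w), by
      rw [zmultiplesHom_apply, natCast_zsmul, ← ofMul_pow, hw, ofMul_one]⟩ 1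
  rw [Int.cast_one] at this
  refine (congrArg Additive.toMul this).trans ?_
  simp

theorem zmod_hom_ext {H : Type*} [Group H] {q : ℕ} {f g : Multiplicative (ZMod q) →* H}
    (h : f (Multiplicative.ofAdd 1) = g (Multiplicative.ofAdd 1)) : f = g := by
  refine MonoidHom.ext fun z => ?_
  have hz : z = Multiplicative.ofAdd (1 : ZMod q) ^ (z.toAdd.cast : ℤ) := by
    rw [← ofAdd_zsmul, zsmul_one, ZMod.intCast_cast, ZMod.cast_id]
    rfl
  rw [hz, map_zpow, map_zpow, h]

theorem zmod_mem_of_one_mem {H : Type*} [Group H] {q : ℕ} (f : Multiplicative (ZMod q) →* H)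
    {W : Subgroup H} (h : f (Multiplicative.ofAdd 1) ∈ W) (z : Multiplicative (ZMod q)) :
    f z ∈ W := by
  have hz : z = Multiplicative.ofAdd (1 : ZMod q) ^ (z.toAdd.cast : ℤ) := by
    rw [← ofAdd_zsmul, zsmul_one, ZMod.intCast_cast, ZMod.cast_id]
    rfl
  rw [hz, map_zpow]
  exact zpow_mem h _

/-- The bimultiplicative map `(x, y) ↦ c x * d y` with values in `ℤ/q`, where `d` is reduced
from `ℤ/r` to `ℤ/q`. -/
def zmodBimul {q r : ℕ} (h : q ∣ r) (c : G →* Multiplicative (ZMod q))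
    (d : G →* Multiplicative (ZMod r)) : G →* G →* Multiplicative (ZMod q) :=
  MonoidHom.mk' (fun x => MonoidHom.mk'
      (fun y => Multiplicative.ofAdd ((c x).toAdd * ZMod.castHom h (ZMod q) (d y).toAdd))
      fun y z => by rw [map_mul d, toAdd_mul, map_add, mul_add, ofAdd_add])
    fun x y => MonoidHom.ext fun z => by
      simp only [MonoidHom.mk'_apply, MonoidHom.mul_apply]
      rw [map_mul c, toAdd_mul, add_mul, ofAdd_add]

theorem zmodBimul_apply {q r : ℕ} (h : q ∣ r) (c : G →* Multiplicative (ZMod q))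
    (d : G →* Multiplicative (ZMod r)) (x y : G) :
    zmodBimul h c d x y =
      Multiplicative.ofAdd ((c x).toAdd * ZMod.castHom h (ZMod q) (d y).toAdd) := rfl

theorem zmodBimul_eq_one {q r : ℕ} (h : q ∣ r) {c : G →* Multiplicative (ZMod q)}
    {d : G →* Multiplicative (ZMod r)} {x y : G} (hxy : c x = 1 ∨ d y = 1) :
    zmodBimul h c d x y = 1 := by
  rw [zmodBimul_apply]
  rcases hxy with hx | hx
  · rw [hx, toAdd_one, zero_mul, ofAdd_zero]
  · rw [hx, toAdd_one, map_zero, mul_zero, ofAdd_zero]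

theorem zmodBimul_eq_ofAdd_one {q r : ℕ} (h : q ∣ r) {c : G →* Multiplicative (ZMod q)}
    {d : G →* Multiplicative (ZMod r)} {x y : G} (hx : c x = Multiplicative.ofAdd 1)
    (hy : d y = Multiplicative.ofAdd 1) :
    zmodBimul h c d x y = Multiplicative.ofAdd 1 := by
  rw [zmodBimul_apply, hx, hy, toAdd_ofAdd, toAdd_ofAdd, map_one, mul_one]

theorem pi_zmod_eq_top {ι : Type*} [Finite ι] [DecidableEq ι] (q : ι → ℕ)
    (W : Subgroup ((i : ι) → Multiplicative (ZMod (q i))))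
    (h : ∀ i, (Pi.mulSingle i (Multiplicative.ofAdd 1) :
      (i : ι) → Multiplicative (ZMod (q i))) ∈ W) : W = ⊤ := by
  rw [eq_top_iff]
  intro y _
  refine Subgroup.pi_mem_of_mulSingle_mem y fun i => ?_
  exact zmod_mem_of_one_mem (MonoidHom.mulSingle (fun i => Multiplicative (ZMod (q i))) i) (h i) (y i)

variable {n : ℕ} {q : Fin n → ℕ}

/-- Index set of the generators of `∇(G)`. -/
abbrev PairIndex (n : ℕ) : Type := (i : Fin n) × {j : Fin n // i ≤ j}

/-- The elements `diag (x i)` and `symm (x i) (x j)`, `i < j`, generate `∇(G)` and have order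
dividing `q i`, so `∏_{i ≤ j} ℤ/q_i` maps onto it. Products of coordinates of `G^ab` give a left
inverse. With `i` counted from `0`, there are `n - i` indices `j ≥ i`. -/
theorem card_nabla (hq0 : ∀ i, q i ≠ 0) (hq : ∀ i, Odd (q i)) (hdvd : ∀ i j, i ≤ j → q i ∣ q j)
    (φ : Abelianization G ≃* ((i : Fin n) → Multiplicative (ZMod (q i)))) :
    Nat.card (nabla G) = ∏ i : Fin n, q i ^ (n - i.val) := by
  let π : G →* ((i : Fin n) → Multiplicative (ZMod (q i))) := φ.toMonoidHom.comp Abelianization.of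
  have hπ : Function.Surjective π :=
    φ.surjective.comp (QuotientGroup.mk'_surjective (commutator G))
  have hπ1 : ∀ g, π g = 1 → g ∈ commutator G := fun g hg => by
    rw [← Abelianization.ker_of, MonoidHom.mem_ker]
    exact φ.injective (hg.trans (map_one φ).symm)
  choose x hx using fun i : Fin n => hπ (Pi.mulSingle i (Multiplicative.ofAdd 1))
  let c : (i : Fin n) → G →* Multiplicative (ZMod (q i)) := fun i => (Pi.evalMonoidHom _ i).comp π
  have c_self : ∀ i, c i (x i) = Multiplicative.ofAdd 1 := fun i => by
    change π (x i) i = _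
    rw [hx, Pi.mulSingle_eq_same]
  have c_ne : ∀ i j, i ≠ j → c i (x j) = 1 := fun i j h => by
    change π (x j) i = _
    rw [hx, Pi.mulSingle_eq_of_ne h]
  have hpow : ∀ i, x i ^ q i ∈ commutator G := fun i => hπ1 _ (by
    rw [map_pow, hx, ← Pi.mulSingle_pow, ← ofAdd_nsmul, nsmul_one, ZMod.natCast_self, ofAdd_zero,
      Pi.mulSingle_one])
  have hgen : commutator G ⊔ Subgroup.closure (Set.range x) = ⊤ := by
    rw [eq_top_iff]
    intro g _
    have h1 : (Subgroup.closure (Set.range x)).map π = ⊤ := pi_zmod_eq_top q _ fun i =>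
      ⟨x i, Subgroup.subset_closure ⟨i, rfl⟩, hx i⟩
    obtain ⟨s, hs, hsg⟩ : π g ∈ (Subgroup.closure (Set.range x)).map π := by
      rw [h1]; trivial
    have h2 : g * s⁻¹ ∈ commutator G := hπ1 _ (by rw [map_mul, map_inv, hsg, mul_inv_cancel])
    have := mul_mem (Subgroup.mem_sup_left h2) (Subgroup.mem_sup_right hs)
    rwa [inv_mul_cancel_right] at this
  let w : PairIndex n → Subgroup.center (NonabelianTensorSquare G) := fun t =>
    if t.1 = t.2.1 then diag (x t.1) else symm (x t.1) (x t.2.1)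
  have hw : ∀ t, w t ^ q t.1 = 1 := by
    intro t
    simp only [w]
    split_ifs with h
    · exact diag_pow_eq_one (hq _) (hpow _)
    · exact symm_pow_eq_one (hpow _) _
  let Φ : ((t : PairIndex n) → Multiplicative (ZMod (q t.1))) →*
      Subgroup.center (NonabelianTensorSquare G) :=
    ∏ t, (zmodHom (q t.1) (w t) (hw t)).comp (Pi.evalMonoidHom _ t)
  have hΦ : ∀ t, Φ (Pi.mulSingle t (Multiplicative.ofAdd 1)) = w t := by
    intro t
    simp only [Φ, MonoidHom.finsetProd_apply, MonoidHom.comp_apply, Pi.evalMonoidHom_apply]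
    rw [Finset.prod_eq_single t]
    · rw [Pi.mulSingle_eq_same, zmodHom_one]
    · intro s _ hs
      rw [Pi.mulSingle_eq_of_ne hs, map_one]
    · simp
  let Φ' := (Subgroup.center (NonabelianTensorSquare G)).subtype.comp Φ
  let Ψ : NonabelianTensorSquare G →* ((t : PairIndex n) → Multiplicative (ZMod (q t.1))) :=
    MonoidHom.pi fun t => ofBimul (zmodBimul (hdvd _ _ t.2.2) (c t.1) (c t.2.1))
  have hΨ : ∀ t s, Ψ (w t : NonabelianTensorSquare G) s =
      (Pi.mulSingle t (Multiplicative.ofAdd 1) :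
        (t : PairIndex n) → Multiplicative (ZMod (q t.1))) s := by
    rintro ⟨i, j, hij⟩ ⟨k, l, hkl⟩
    change ofBimul (zmodBimul (hdvd k l hkl) (c k) (c l)) _ = _
    by_cases heq : (⟨k, l, hkl⟩ : PairIndex n) = ⟨i, j, hij⟩
    · obtain ⟨rfl, h2⟩ := Sigma.mk.inj_iff.1 heq
      obtain rfl : l = j := congrArg Subtype.val (eq_of_heq h2)
      rw [Pi.mulSingle_eq_same]
      simp only [w]
      split_ifs with h
      · subst h
        change ofBimul _ (tmul _ _) = _
        rw [ofBimul_tmul]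
        exact zmodBimul_eq_ofAdd_one _ (c_self _) (c_self _)
      · change ofBimul _ (tmul _ _ * tmul _ _) = _
        rw [map_mul, ofBimul_tmul, ofBimul_tmul,
          zmodBimul_eq_ofAdd_one _ (c_self _) (c_self _),
          zmodBimul_eq_one _ (Or.inl (c_ne _ _ h)), mul_one]
    · rw [Pi.mulSingle_eq_of_ne heq]
      have hne : k ≠ i ∨ l ≠ j := by
        by_contra hcon
        push Not at hcon
        obtain ⟨rfl, rfl⟩ := hcon
        exact heq rfl
      simp only [w]
      split_ifs with h
      · subst h
        change ofBimul _ (tmul _ _) = _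
        rw [ofBimul_tmul]
        exact zmodBimul_eq_one _ (hne.imp (c_ne _ _) (c_ne _ _))
      · change ofBimul _ (tmul _ _ * tmul _ _) = _
        rw [map_mul, ofBimul_tmul, ofBimul_tmul,
          zmodBimul_eq_one _ (hne.imp (c_ne _ _) (c_ne _ _)), one_mul]
        -- The second term `x_j ⊗ x_i` could only be detected by `(k, l) = (j, i)`, which with `k ≤
        -- l` and `i ≤ j` would force `i = j`.
        apply zmodBimul_eq_one
        by_contra hcon
        push Not at hcon
        have h1 : k = j := by_contra fun h' => hcon.1 (c_ne _ _ h')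
        have h2 : l = i := by_contra fun h' => hcon.2 (c_ne _ _ h')
        subst h1 h2
        exact h (le_antisymm hij hkl)
  have hΨΦ : Ψ.comp Φ' = MonoidHom.id _ := by
    refine MonoidHom.functions_ext' _ _ _ fun t => zmod_hom_ext ?_
    change Ψ (Φ (Pi.mulSingle t (Multiplicative.ofAdd 1))) = _
    rw [hΦ]
    ext s : 1
    exact hΨ t s
  have hinj : Function.Injective Φ' := by
    have : Function.LeftInverse Ψ Φ' := fun y => DFunLike.congr_fun hΨΦ y
    exact this.injective
  have hrange : Φ'.range = nabla G := by
    apply le_antisymm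
    · have : (nabla G).comap Φ' = ⊤ := by
        apply pi_zmod_eq_top
        intro t
        change (Φ _ : NonabelianTensorSquare G) ∈ nabla G
        rw [hΦ]
        simp only [w]
        split_ifs
        · exact tmul_self_mem_nabla _
        · exact symm_mem_nabla _ _
      rintro _ ⟨y, rfl⟩
      change y ∈ (nabla G).comap Φ'
      rw [this]
      trivial
    · rw [nabla, Subgroup.closure_le]
      rintro _ ⟨g, rfl⟩
      obtain ⟨y, hy⟩ : diag g ∈ Φ.range := by
        refine diag_mem_of_generators x hgen Φ.range (fun i => ?_) (fun i j h => ?_) g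
        · refine ⟨_, (hΦ ⟨i, i, le_rfl⟩).trans ?_⟩
          simp [w]
        · refine ⟨_, (hΦ ⟨i, j, h.le⟩).trans ?_⟩
          simp [w, h.ne]
      exact ⟨y, congrArg Subtype.val hy⟩
  have : ∀ t : PairIndex n, NeZero (q t.1) := fun t => ⟨hq0 _⟩
  rw [← hrange, ← Nat.card_congr (MonoidHom.ofInjective hinj).toEquiv, Nat.card_pi]
  have hc : ∀ t : PairIndex n, Nat.card (Multiplicative (ZMod (q t.1))) = q t.1 := fun t => by
    rw [Nat.card_congr Multiplicative.toAdd, Nat.card_zmod]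
  simp only [hc]
  rw [Fintype.prod_sigma]
  refine Finset.prod_congr rfl fun i _ => ?_
  change ∏ _y : {j : Fin n // i ≤ j}, q i = _
  rw [Finset.prod_const, Finset.card_univ, Fintype.card_subtype]
  congr 1
  rw [← Fin.card_Ici]
  congr 1
  ext j
  simp

end NonabelianTensorSquare

/-! ### Hirsch length through chains of subgroups -/

namespace Polycyclic

variable {G : Type*} [Group G]

/-- `H` is a normal subgroup of `K` with cyclic quotient. -/
def CycStep (H K : Subgroup G) : Prop :=
  H ≤ K ∧ (∀ g ∈ K, ∀ h ∈ H, g * h * g⁻¹ ∈ H) ∧ ∃ x ∈ K, ∀ g ∈ K, ∃ n : ℤ, x ^ n * g ∈ H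

/-- The contribution of a cyclic factor `K / H` to the Hirsch length. -/
noncomputable def stepLength (H K : Subgroup G) : ℕ := if H.relIndex K = 0 then 1 else 0

/-- `HasHirsch K k` says that `K` has a polycyclic series with `k` infinite factors. -/
inductive HasHirsch : Subgroup G → ℕ → Prop
  | bot : HasHirsch ⊥ 0
  | step {H K : Subgroup G} {k : ℕ} (hHK : CycStep H K) (hH : HasHirsch H k) :
      HasHirsch K (k + stepLength H K)

theorem CycStep.normal {H K : Subgroup G} (h : CycStep H K) : (H.subgroupOf K).Normal where
  conj_mem a ha g := h.2.1 g g.2 a ha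

theorem CycStep.isCyclic {H K : Subgroup G} (h : CycStep H K) [(H.subgroupOf K).Normal] :
    IsCyclic (K ⧸ H.subgroupOf K) := by
  obtain ⟨x, hx, hg⟩ := h.2.2
  refine ⟨⟨QuotientGroup.mk' (H.subgroupOf K) ⟨x, hx⟩, fun y => ?_⟩⟩
  obtain ⟨g, rfl⟩ := QuotientGroup.mk'_surjective _ y
  obtain ⟨n, hn⟩ := hg g g.2
  refine ⟨-n, ?_⟩
  change QuotientGroup.mk' (H.subgroupOf K) ⟨x, hx⟩ ^ (-n) = QuotientGroup.mk' (H.subgroupOf K) g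
  rw [← map_zpow]
  refine QuotientGroup.eq.2 ?_
  rw [zpow_neg, inv_inv]
  exact hn

theorem cycStep_of_hom {H K : Subgroup G} (hHK : H ≤ K) {C : Type*} [Group C] [IsCyclic C]
    (φ : K →* C) (hφ : ∀ k : K, φ k = 1 ↔ k.1 ∈ H) : CycStep H K := by
  refine ⟨hHK, fun g hg h hh => ?_, ?_⟩
  · have := (hφ ⟨h, hHK hh⟩).2 hh
    refine (hφ (⟨g, hg⟩ * ⟨h, hHK hh⟩ * ⟨g, hg⟩⁻¹)).1 ?_
    rw [map_mul, map_mul, this, mul_one, map_inv, mul_inv_cancel]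
  · obtain ⟨⟨_, x, rfl⟩, hx⟩ := IsCyclic.exists_generator (α := φ.range)
    refine ⟨x, x.2, fun g hg => ?_⟩
    obtain ⟨n, hn⟩ := hx ⟨φ ⟨g, hg⟩, _, rfl⟩
    refine ⟨-n, (hφ (x ^ (-n) * ⟨g, hg⟩)).1 ?_⟩
    have : φ x ^ n = φ ⟨g, hg⟩ := congrArg Subtype.val hn
    rw [map_mul, map_zpow, ← this, zpow_neg, inv_mul_cancel]

theorem cycStep_iff {H K : Subgroup G} : CycStep H K ↔ H ≤ K ∧
    ∃ _ : (H.subgroupOf K).Normal, IsCyclic (K ⧸ H.subgroupOf K) := by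
  constructor
  · intro h
    exact ⟨h.1, h.normal, h.normal.recOn fun _ => by have := h.normal; exact h.isCyclic⟩
  · rintro ⟨h, hn, hc⟩
    refine cycStep_of_hom h (QuotientGroup.mk' (H.subgroupOf K)) fun k => ?_
    exact QuotientGroup.eq_one_iff k

theorem CycStep.inf {H K : Subgroup G} (h : CycStep H K) (L : Subgroup G) :
    CycStep (H ⊓ L) (K ⊓ L) := by
  have := h.normal
  have := h.isCyclic
  refine cycStep_of_hom (inf_le_inf_right L h.1)
    ((QuotientGroup.mk' (H.subgroupOf K)).comp (Subgroup.inclusion inf_le_left)) fun k => ?_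
  refine (QuotientGroup.eq_one_iff _).trans ?_
  exact ⟨fun hk => ⟨hk, k.2.2⟩, fun hk => hk.1⟩

/-- A nontrivial subgroup of a cyclic group has finite index, so the two layers of `K / A` cannot
both be infinite. Infinite index is encoded as `relIndex = 0`. -/
theorem stepLength_add {A C K : Subgroup G} (h : CycStep A K) (hAC : A ≤ C) (hCK : C ≤ K) :
    stepLength A K = stepLength A C + stepLength C K := by
  have hmul := Subgroup.relIndex_mul_relIndex A C K hAC hCK
  have key : A.relIndex C = 0 → C.relIndex K ≠ 0 := by
    intro h0
    obtain ⟨x, hx, hg⟩ := h.2.2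
    obtain ⟨c, hc, hcA⟩ : ∃ c ∈ C, c ∉ A := by
      by_contra hcon
      push Not at hcon
      rw [Subgroup.relIndex_eq_one.2 hcon] at h0
      exact one_ne_zero h0
    obtain ⟨n, hn⟩ := hg c (hCK hc)
    have hn0 : n ≠ 0 := by
      rintro rfl
      rw [zpow_zero, one_mul] at hn
      exact hcA hn
    have hxn : x ^ n ∈ C := by
      have := mul_mem (hAC hn) (inv_mem hc)
      rwa [mul_inv_cancel_right] at this
    let f : Set.Ico (0 : ℤ) |n| → K ⧸ C.subgroupOf K := fun r =>
      QuotientGroup.mk ⟨x ^ r.1, zpow_mem hx _⟩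
    have hf : Function.Surjective f := by
      intro y
      obtain ⟨g, rfl⟩ := Quotient.exists_rep y
      obtain ⟨m, hm⟩ := hg _ (inv_mem g.2)
      refine ⟨⟨m % n, Int.emod_nonneg _ hn0, Int.emod_lt_abs _ hn0⟩, ?_⟩
      refine QuotientGroup.eq.2 ?_
      change (x ^ (m % n))⁻¹ * g.1 ∈ C
      have h1 := h.2.1 _ (zpow_mem hx (-m)) _ (inv_mem hm)
      have h2 : x ^ (-m) * g.1 ∈ C := by
        convert hAC h1 using 1
        group
      have h3 : (x ^ (m % n))⁻¹ * g.1 = (x ^ n) ^ (m / n) * (x ^ (-m) * g.1) := by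
        rw [← zpow_mul, ← mul_assoc, ← zpow_add, ← zpow_neg]
        congr 2
        have := Int.emod_add_mul_ediv m n
        linarith
      rw [h3]
      exact mul_mem (zpow_mem hxn _) h2
    have : Finite (K ⧸ C.subgroupOf K) := Finite.of_surjective f hf
    exact Subgroup.index_ne_zero_of_finite
  unfold stepLength
  by_cases h1 : A.relIndex C = 0
  · have h2 := key h1
    rw [h1, zero_mul] at hmul
    simp [h1, h2, ← hmul]
  · by_cases h2 : C.relIndex K = 0
    · rw [h2, mul_zero] at hmul
      simp [h1, h2, ← hmul]
    · have : A.relIndex K ≠ 0 := by rw [← hmul]; exact mul_ne_zero h1 h2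
      simp [h1, h2, this]

theorem relIndex_sup_of_cycStep {A B K : Subgroup G} (hA : CycStep A K) (hB : B ≤ K) :
    A.relIndex (A ⊔ B) = (A ⊓ B).relIndex B := by
  have := hA.normal
  rw [Subgroup.inf_relIndex_right, ← Subgroup.relIndex_subgroupOf (sup_le hA.1 hB),
    ← Subgroup.relIndex_subgroupOf hB, Subgroup.subgroupOf_sup hA.1 hB,
    Subgroup.relIndex_sup_left]

/-- Both sides pass through `A ⊔ B`: split `K / A` and `K / B` there and exchange the lower layers
by the second isomorphism theorem. -/
theorem stepLength_square {A B K : Subgroup G} (hA : CycStep A K) (hB : CycStep B K) :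
    stepLength (A ⊓ B) B + stepLength B K = stepLength (A ⊓ B) A + stepLength A K := by
  have h1 := stepLength_add hA (le_sup_left (b := B)) (sup_le hA.1 hB.1)
  have h2 := stepLength_add hB (le_sup_right (a := A)) (sup_le hA.1 hB.1)
  have h3 : stepLength A (A ⊔ B) = stepLength (A ⊓ B) B := by
    rw [stepLength, relIndex_sup_of_cycStep hA hB.1, stepLength]
  have h4 : stepLength B (A ⊔ B) = stepLength (A ⊓ B) A := by
    rw [stepLength, sup_comm, relIndex_sup_of_cycStep hB hA.1, inf_comm, stepLength]
  omega

/-- The Jordan–Hölder exchange: intersect the series with `L` and carry the count along it with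
`stepLength_square`. -/
theorem HasHirsch.inf_of_cycStep {L K₀ K : Subgroup G} {k : ℕ} (hL : CycStep L K₀)
    (hK : HasHirsch K k) (hle : K ≤ K₀) :
    ∃ a, HasHirsch (L ⊓ K) a ∧ k = a + stepLength (L ⊓ K) K := by
  induction hK with
  | bot =>
    refine ⟨0, by rw [inf_bot_eq]; exact .bot, ?_⟩
    simp [stepLength]
  | @step H K k hHK _ ih =>
    obtain ⟨a, ha, rfl⟩ := ih (hHK.1.trans hle)
    have h1 : CycStep (L ⊓ H) (L ⊓ K) := by
      rw [inf_comm L, inf_comm L]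
      exact hHK.inf L
    have h2 : CycStep (L ⊓ K) K := by
      have := hL.inf K
      rwa [inf_eq_right.2 hle] at this
    have h3 := stepLength_square h2 hHK
    have h4 : L ⊓ K ⊓ H = L ⊓ H := by rw [inf_assoc, inf_eq_right.2 hHK.1]
    rw [h4] at h3
    exact ⟨_, .step h1 ha, by omega⟩

theorem HasHirsch.eq_zero_of_finite {K : Subgroup G} {k : ℕ} (hK : HasHirsch K k)
    (hf : (K : Set G).Finite) : k = 0 := by
  induction hK with
  | bot => rfl
  | @step H K k hHK _ ih =>
    have : Finite K := hf
    rw [ih (hf.subset hHK.1), stepLength, if_neg]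
    exact Subgroup.index_ne_zero_of_finite

/-- Induct on the first series; the exchange lemma reroutes the second one through the penultimate
term of the first. -/
theorem HasHirsch.unique {K : Subgroup G} {k k' : ℕ} (hK : HasHirsch K k)
    (hK' : HasHirsch K k') : k = k' := by
  induction hK generalizing k' with
  | bot => exact (hK'.eq_zero_of_finite (by simp)).symm
  | @step H K k hHK _ ih =>
    obtain ⟨a, ha, rfl⟩ := hK'.inf_of_cycStep hHK le_rfl
    rw [inf_eq_left.2 hHK.1] at ha ⊢
    rw [ih ha]

theorem HasHirsch.inf {K : Subgroup G} {k : ℕ} (hK : HasHirsch K k) (L : Subgroup G) :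
    ∃ a, HasHirsch (K ⊓ L) a := by
  induction hK with
  | bot => exact ⟨0, by rw [bot_inf_eq]; exact .bot⟩
  | step hHK _ ih =>
    obtain ⟨a, ha⟩ := ih
    exact ⟨_, .step (hHK.inf L) ha⟩

theorem HasHirsch.of_le {K L : Subgroup G} {k : ℕ} (hK : HasHirsch K k) (hL : L ≤ K) :
    ∃ a, HasHirsch L a := by
  have := hK.inf L
  rwa [inf_eq_right.2 hL] at this

variable {Q : Type*} [Group Q]

theorem map_inf_comap_eq {f : G →* Q} {D : Subgroup G} {K : Subgroup Q} (hK : K ≤ D.map f) :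
    (D ⊓ K.comap f).map f = K := by
  apply le_antisymm
  · rintro _ ⟨x, hx, rfl⟩
    exact hx.2
  · intro y hy
    obtain ⟨x, hx, rfl⟩ := hK hy
    exact ⟨x, ⟨hx, hy⟩, rfl⟩

/-- Additivity of the Hirsch length in extensions. -/
theorem HasHirsch.extension {f : G →* Q} {D : Subgroup G} {a b : ℕ} {L : Subgroup Q}
    (ha : HasHirsch (D ⊓ f.ker) a) (hL : HasHirsch L b) (hD : L ≤ D.map f) :
    HasHirsch (D ⊓ L.comap f) (a + b) := by
  induction hL with
  | bot => exact ha
  | @step H K k hHK _ ih =>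
    have h1 : CycStep (D ⊓ H.comap f) (D ⊓ K.comap f) := by
      refine ⟨inf_le_inf_left D (Subgroup.comap_mono hHK.1), fun g hg h hh => ⟨?_, ?_⟩, ?_⟩
      · exact D.mul_mem (D.mul_mem hg.1 hh.1) (D.inv_mem hg.1)
      · change f (g * h * g⁻¹) ∈ H
        rw [map_mul, map_mul, map_inv]
        exact hHK.2.1 _ hg.2 _ hh.2
      · obtain ⟨x, hx, hg⟩ := hHK.2.2
        obtain ⟨x, hxD, rfl⟩ := hD hx
        refine ⟨x, ⟨hxD, hx⟩, fun g hgD => ?_⟩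
        obtain ⟨n, hn⟩ := hg _ hgD.2
        refine ⟨n, mul_mem (zpow_mem hxD n) hgD.1, ?_⟩
        change f (x ^ n * g) ∈ H
        rwa [map_mul, map_zpow]
    have h2 : stepLength (D ⊓ H.comap f) (D ⊓ K.comap f) = stepLength H K := by
      have : (D ⊓ H.comap f).relIndex (D ⊓ K.comap f) = H.relIndex K := by
        have h3 : D ⊓ H.comap f ⊓ (D ⊓ K.comap f) = H.comap f ⊓ (D ⊓ K.comap f) := by
          ext y
          simp only [Subgroup.mem_inf]
          tauto
        rw [← Subgroup.inf_relIndex_right, h3, Subgroup.inf_relIndex_right,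
          Subgroup.relIndex_comap, map_inf_comap_eq hD]
      rw [stepLength, this, stepLength]
    have h3 := HasHirsch.step h1 (ih (hHK.1.trans hD))
    rwa [h2, add_assoc] at h3

theorem HasHirsch.top_of_surjective {f : G →* Q} (hf : Function.Surjective f) {a b : ℕ}
    (ha : HasHirsch f.ker a) (hb : HasHirsch (⊤ : Subgroup Q) b) :
    HasHirsch (⊤ : Subgroup G) (a + b) := by
  have := HasHirsch.extension (f := f) (D := ⊤) (L := ⊤) (by rwa [top_inf_eq]) hb
    (by rw [← MonoidHom.range_eq_map, MonoidHom.range_eq_top.2 hf])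
  rwa [Subgroup.comap_top, inf_idem] at this

theorem HasHirsch.map {f : G →* Q} (hf : Function.Injective f) {K : Subgroup G} {k : ℕ}
    (hK : HasHirsch K k) : HasHirsch (K.map f) k := by
  induction hK with
  | bot => rw [Subgroup.map_bot]; exact .bot
  | @step H K k hHK _ ih =>
    have h1 : CycStep (H.map f) (K.map f) := by
      refine ⟨Subgroup.map_mono hHK.1, ?_, ?_⟩
      · rintro _ ⟨g, hg, rfl⟩ _ ⟨h, hh, rfl⟩
        exact ⟨_, hHK.2.1 g hg h hh, by simp⟩
      · obtain ⟨x, hx, hg⟩ := hHK.2.2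
        refine ⟨f x, ⟨x, hx, rfl⟩, ?_⟩
        rintro _ ⟨g, hgK, rfl⟩
        obtain ⟨n, hn⟩ := hg g hgK
        exact ⟨n, _, hn, by simp⟩
    have h2 : stepLength (H.map f) (K.map f) = stepLength H K := by
      rw [stepLength, Subgroup.relIndex_map_map_of_injective _ _ hf, stepLength]
    rw [← h2]
    exact .step h1 ih

theorem HasHirsch.comap {f : G →* Q} (hf : Function.Injective f) {L : Subgroup Q} {k : ℕ}
    (hL : HasHirsch L k) (hle : L ≤ f.range) : HasHirsch (L.comap f) k := by
  have h0 : HasHirsch (⊤ ⊓ f.ker) 0 := by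
    rw [(MonoidHom.ker_eq_bot_iff f).2 hf, inf_bot_eq]
    exact .bot
  have := HasHirsch.extension h0 hL (by rwa [← MonoidHom.range_eq_map])
  rwa [top_inf_eq, zero_add] at this

/-- The Hirsch length of a subgroup does not depend on the ambient group. -/
theorem hasHirsch_top_iff {K : Subgroup G} {k : ℕ} :
    HasHirsch (⊤ : Subgroup K) k ↔ HasHirsch K k := by
  constructor
  · intro h
    have := h.map K.subtype_injective
    rwa [← MonoidHom.range_eq_map, Subgroup.range_subtype] at this
  · intro h
    have := h.comap K.subtype_injective (by rw [Subgroup.range_subtype])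
    rwa [show K.comap K.subtype = ⊤ from Subgroup.subgroupOf_self K] at this

theorem cycStep_closure_insert {S : Set G} {a : G} (ha : ∀ g, g * a = a * g) :
    CycStep (Subgroup.closure S) (Subgroup.closure (insert a S)) := by
  have hc : ∀ (n : ℤ) g, g * a ^ n = a ^ n * g := fun n g =>
    ((show Commute g a from ha g).zpow_right n).eq
  have h3 : ∀ g ∈ Subgroup.closure (insert a S), ∃ n : ℤ, a ^ n * g ∈ Subgroup.closure S := by
    intro g hg
    induction hg using Subgroup.closure_induction with
    | mem x hx =>
      rcases hx with rfl | hx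
      · exact ⟨-1, by simp [one_mem]⟩
      · exact ⟨0, by simpa using Subgroup.subset_closure hx⟩
    | one => exact ⟨0, by simp [one_mem]⟩
    | mul x y _ _ hx hy =>
      obtain ⟨n, hn⟩ := hx
      obtain ⟨m, hm⟩ := hy
      refine ⟨n + m, ?_⟩
      have : a ^ (n + m) * (x * y) = a ^ n * x * (a ^ m * y) := by
        rw [zpow_add, mul_assoc, ← mul_assoc (a ^ m), ← hc m x]
        simp only [mul_assoc]
      rw [this]
      exact mul_mem hn hm
    | inv x _ hx =>
      obtain ⟨n, hn⟩ := hx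
      refine ⟨-n, ?_⟩
      rw [← hc, zpow_neg, ← mul_inv_rev]
      exact inv_mem hn
  refine ⟨Subgroup.closure_mono (Set.subset_insert a S), fun g hg h hh => ?_,
    a, Subgroup.subset_closure (Set.mem_insert a S), h3⟩
  obtain ⟨n, hn⟩ := h3 g hg
  have : g * h * g⁻¹ = a ^ n * g * h * (a ^ n * g)⁻¹ := by
    rw [← hc]; group
    rw [hc, hc]; group
  rw [this]
  exact mul_mem (mul_mem hn hh) (inv_mem hn)

theorem exists_hasHirsch_of_fg_central {A : Subgroup G} (hA : A ≤ Subgroup.center G)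
    (hfg : A.FG) : ∃ k, HasHirsch A k := by
  obtain ⟨S, rfl⟩ := hfg
  rw [Subgroup.closure_le] at hA
  generalize hT : (S : Set G) = T at hA
  have hTf : T.Finite := hT ▸ S.finite_toSet
  clear hT
  induction T, hTf using Set.Finite.induction_on with
  | empty => exact ⟨0, by rw [Subgroup.closure_empty]; exact .bot⟩
  | @insert a T _ _ ih =>
    rw [Set.insert_subset_iff] at hA
    obtain ⟨k, hk⟩ := ih hA.2
    exact ⟨_, .step (cycStep_closure_insert (Subgroup.mem_center_iff.1 hA.1)) hk⟩

theorem HasHirsch.fg {K : Subgroup G} {k : ℕ} (hK : HasHirsch K k) : K.FG := by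
  induction hK with
  | bot => exact Subgroup.FG.bot
  | @step H K k hHK _ ih =>
    obtain ⟨x, hx, hg⟩ := hHK.2.2
    have h1 : K = H ⊔ Subgroup.closure {x} := by
      apply le_antisymm
      · intro g hgK
        obtain ⟨n, hn⟩ := hg g hgK
        have hx' : x ∈ H ⊔ Subgroup.closure {x} :=
          Subgroup.mem_sup_right (Subgroup.subset_closure (Set.mem_singleton x))
        have hn' : x ^ n * g ∈ H ⊔ Subgroup.closure {x} := Subgroup.mem_sup_left hn
        rwa [Subgroup.mul_mem_cancel_left _ (zpow_mem hx' n)] at hn'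
      · rw [sup_le_iff, Subgroup.closure_le, Set.singleton_subset_iff]
        exact ⟨hHK.1, hx⟩
    rw [h1]
    exact ih.sup ⟨{x}, by simp⟩

/-- A finitely generated central extension of a polycyclic group has finitely generated kernel. -/
theorem HasHirsch.fg_inf_ker {π : G →* Q} (hπ : π.ker ≤ Subgroup.center G) {H : Subgroup Q}
    {k : ℕ} (hH : HasHirsch H k) (D : Subgroup G) (hD : D.FG) (hDH : D.map π = H) :
    (D ⊓ π.ker).FG := by
  induction hH generalizing D with
  | bot =>
    rw [Subgroup.map_eq_bot_iff] at hDH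
    rwa [inf_eq_left.2 hDH]
  | @step H₁ H k hstep hH₁ ih =>
    have hker : D ⊓ H₁.comap π ⊓ π.ker = D ⊓ π.ker := by
      ext y
      simp only [Subgroup.mem_inf, Subgroup.mem_comap]
      constructor
      · exact fun h => ⟨h.1.1, h.2⟩
      · exact fun h => ⟨⟨h.1, by rw [h.2]; exact one_mem _⟩, h.2⟩
    have hmap : (D ⊓ H₁.comap π).map π = H₁ := map_inf_comap_eq (by rw [hDH]; exact hstep.1)
    -- The preimage of `H₁` in `D` contains all of `D ⊓ π.ker`, so induction applies once this
    -- preimage is finitely generated.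
    suffices h : (D ⊓ H₁.comap π).FG by rw [← hker]; exact ih _ h hmap
    have hcen : ∀ a ∈ π.ker, ∀ g, g * a = a * g := fun a ha => Subgroup.mem_center_iff.1 (hπ ha)
    generalize hD₁ : D ⊓ H₁.comap π = D₁ at hmap ⊢
    have hD₁D : D₁ ≤ D := hD₁ ▸ inf_le_left
    have hkerD₁ : ∀ a ∈ D, π a = 1 → a ∈ D₁ := fun a ha h => by
      rw [← hD₁]
      exact ⟨ha, by change π a ∈ H₁; rw [h]; exact one_mem _⟩
    have hmemD₁ : ∀ g, g ∈ D₁ ↔ g ∈ D ∧ π g ∈ H₁ := fun g => by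
      rw [← hD₁, Subgroup.mem_inf, Subgroup.mem_comap]
    obtain ⟨x, hx, hgen⟩ := hstep.2.2
    obtain ⟨t, htD, rfl⟩ : x ∈ D.map π := by rwa [hDH]
    obtain ⟨Y₀, hY₀⟩ := hD
    obtain ⟨Y₁, hY₁⟩ := hH₁.fg
    have hlift : ∀ y ∈ (Y₁ : Set Q), ∃ u ∈ D₁, π u = y := fun y hy => by
      have : y ∈ D₁.map π := by rw [hmap, ← hY₁]; exact Subgroup.subset_closure hy
      exact this
    choose! u huD hu using hlift
    have hcorr : ∀ g ∈ D₁, ∃ a ∈ D, π a = 1 ∧ g * a ∈ Subgroup.closure (u '' Y₁) := by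
      intro g hg
      have h1 : π g ∈ (Subgroup.closure (u '' Y₁)).map π := by
        rw [MonoidHom.map_closure, Set.image_image, Set.image_congr hu, Set.image_id', hY₁]
        exact ((hmemD₁ g).1 hg).2
      obtain ⟨w, hw, hwg⟩ := h1
      have hwD : Subgroup.closure (u '' Y₁) ≤ D := by
        rw [Subgroup.closure_le]
        rintro _ ⟨y, hy, rfl⟩
        exact hD₁D (huD y hy)
      refine ⟨g⁻¹ * w, mul_mem (inv_mem (hD₁D hg)) (hwD hw), ?_, ?_⟩
      · rw [map_mul, map_inv, hwg, inv_mul_cancel]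
      · rwa [mul_inv_cancel_left]
    choose! c hcD hc1 hcu using hcorr
    -- The exponents `n` with `t ^ n` over `H₁` are the multiples of one integer `m`, so a single
    -- power of `t` accounts for the finite-quotient case.
    let S : AddSubgroup ℤ :=
      { carrier := {n | π t ^ n ∈ H₁}
        zero_mem' := by simp [one_mem]
        add_mem' := fun {a b} ha hb => by
          rw [Set.mem_ofPred_eq] at *
          rw [zpow_add]; exact mul_mem ha hb
        neg_mem' := fun {a} ha => by
          rw [Set.mem_ofPred_eq] at *
          rw [zpow_neg]; exact inv_mem ha }
    obtain ⟨m, hm⟩ := Int.subgroup_cyclic S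
    have hmS : π t ^ m ∈ H₁ := by
      have : m ∈ S := by rw [hm]; exact AddSubgroup.subset_closure rfl
      exact this
    have hgenY : ∀ y ∈ (Y₀ : Set G), ∃ n : ℤ, t ^ n * y ∈ D₁ := by
      intro y hy
      have hyD : y ∈ D := by rw [← hY₀]; exact Subgroup.subset_closure hy
      obtain ⟨n, hn⟩ := hgen (π y) (by rw [← hDH]; exact ⟨y, hyD, rfl⟩)
      refine ⟨n, (hmemD₁ _).2 ⟨mul_mem (zpow_mem htD n) hyD, ?_⟩⟩
      rwa [map_mul, map_zpow]
    choose! e he using hgenY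
    have hconj : ∀ s ∈ D, ∀ g ∈ D₁, s * g * s⁻¹ ∈ D₁ := by
      intro s hs g hg
      rw [hmemD₁] at hg ⊢
      refine ⟨mul_mem (mul_mem hs hg.1) (inv_mem hs), ?_⟩
      rw [map_mul, map_mul, map_inv]
      exact hstep.2.1 _ (by rw [← hDH]; exact ⟨s, hs, rfl⟩) _ hg.2
    -- These finitely many elements must lie in `N` for two purposes: the generators of `D`
    -- corrected by powers of `t`, so that `D` is covered by the cosets `t ^ n N`; conjugates of the
    -- lifts by `t` and `t⁻¹`, so that `t` normalises `N`; and `t ^ m`. Each needs only a central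
    -- correction `c v` beyond the lifts `u`.
    let V : Set G := (fun y => t ^ e y * y) '' Y₀ ∪ (fun y => t * u y * t⁻¹) '' Y₁ ∪
      (fun y => t⁻¹ * u y * t⁻¹⁻¹) '' Y₁ ∪ {t ^ m}
    have hVf : V.Finite := (((Y₀.finite_toSet.image _).union (Y₁.finite_toSet.image _)).union
      (Y₁.finite_toSet.image _)).union (Set.finite_singleton _)
    have hVD : ∀ v ∈ V, v ∈ D₁ := by
      rintro v (((⟨y, hy, rfl⟩ | ⟨y, hy, rfl⟩) | ⟨y, hy, rfl⟩) | rfl)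
      · exact he y hy
      · exact hconj t htD _ (huD y hy)
      · exact hconj t⁻¹ (inv_mem htD) _ (huD y hy)
      · exact (hmemD₁ _).2 ⟨zpow_mem htD m, by rwa [map_zpow]⟩
    let N := Subgroup.closure (u '' Y₁ ∪ c '' V)
    have hVN : ∀ v ∈ V, v ∈ N := by
      intro v hv
      have h1 : v * c v ∈ N := Subgroup.closure_mono Set.subset_union_left (hcu v (hVD v hv))
      have h2 : c v ∈ N := Subgroup.subset_closure (Or.inr ⟨v, hv, rfl⟩)
      exact (Subgroup.mul_mem_cancel_right _ h2).1 h1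
    have hND : N ≤ D₁ := by
      rw [Subgroup.closure_le]
      rintro _ (⟨y, hy, rfl⟩ | ⟨v, hv, rfl⟩)
      · exact huD y hy
      · exact hkerD₁ _ (hcD v (hVD v hv)) (hc1 v (hVD v hv))
    -- The corrections are central, so only conjugates of the lifts need checking.
    have hnorm : ∀ s : G, (∀ y ∈ (Y₁ : Set Q), s * u y * s⁻¹ ∈ N) → ∀ g ∈ N, s * g * s⁻¹ ∈ N := by
      intro s hs
      have : N ≤ N.comap (MulAut.conj s).toMonoidHom := by
        rw [Subgroup.closure_le]
        rintro _ (⟨y, hy, rfl⟩ | ⟨v, hv, rfl⟩)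
        · exact hs y hy
        · change s * c v * s⁻¹ ∈ N
          rw [hcen _ (hc1 v (hVD v hv)), mul_inv_cancel_right]
          exact Subgroup.subset_closure (Or.inr ⟨v, hv, rfl⟩)
      exact this
    have ht1 := hnorm t fun y hy => hVN _ (Or.inl (Or.inl (Or.inr ⟨y, hy, rfl⟩)))
    have ht2 := hnorm t⁻¹ fun y hy => hVN _ (Or.inl (Or.inr ⟨y, hy, rfl⟩))
    have htN : t ∈ Subgroup.normalizer (N : Set G) := by
      rw [Subgroup.mem_normalizer_iff]
      refine fun g => ⟨ht1 g, fun h => ?_⟩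
      have := ht2 _ h
      convert this using 1
      group
    have htn : ∀ (n : ℤ) g, g ∈ N → t ^ n * g * (t ^ n)⁻¹ ∈ N := fun n g hg =>
      (Subgroup.mem_normalizer_iff.1 (zpow_mem htN n) g).1 hg
    let P : Subgroup G :=
      { carrier := {g | ∃ n : ℤ, t ^ n * g ∈ N}
        one_mem' := ⟨0, by simp [one_mem]⟩
        mul_mem' := by
          rintro a b ⟨n, hn⟩ ⟨k, hk⟩
          refine ⟨k + n, ?_⟩
          have := mul_mem (htn k _ hn) hk
          convert this using 1
          rw [zpow_add]
          group
        inv_mem' := by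
          rintro a ⟨n, hn⟩
          refine ⟨-n, ?_⟩
          have := htn (-n) _ (inv_mem hn)
          convert this using 1
          group }
    have hDP : D ≤ P := by
      rw [← hY₀, Subgroup.closure_le]
      exact fun y hy => ⟨e y, hVN _ (Or.inl (Or.inl (Or.inl ⟨y, hy, rfl⟩)))⟩
    -- For `g ∈ D₁`, some `t ^ n * g` lies in `N ≤ D₁`; then `t ^ n` is over `H₁`, so it is a power
    -- of `t ^ m ∈ N`.
    have hD₁N : D₁ = N := by
      refine le_antisymm (fun g hg => ?_) hND
      obtain ⟨n, hn⟩ := hDP (hD₁D hg)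
      have h1 : t ^ n ∈ D₁ := (Subgroup.mul_mem_cancel_right _ hg).1 (hND hn)
      have h2 : n ∈ S := by
        have := ((hmemD₁ _).1 h1).2
        rwa [map_zpow] at this
      rw [hm, AddSubgroup.mem_closure_singleton] at h2
      obtain ⟨j, rfl⟩ := h2
      have h3 : t ^ (j • m) ∈ N := by
        rw [smul_eq_mul, mul_comm, zpow_mul]
        exact zpow_mem (hVN _ (Or.inr rfl)) j
      exact (Subgroup.mul_mem_cancel_left _ h3).1 hn
    rw [hD₁N, Subgroup.fg_iff]
    exact ⟨_, rfl, (Y₁.finite_toSet.image u).union (hVf.image c)⟩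

end Polycyclic

/-! ### Comparison with polycyclic series -/

namespace Polycyclic

variable {G : Type u} [Group G]

open Classical in
theorem stepLength_eq (H K : Subgroup G) :
    stepLength H K = if Infinite (K ⧸ H.subgroupOf K) then 1 else 0 := by
  rw [stepLength]
  exact if_congr Subgroup.index_eq_zero_iff_infinite rfl rfl

theorem infiniteFactors_eq (s : PolycyclicSeries G) :
    s.infiniteFactors = ∑ i : Fin s.length, stepLength (s.term i.castSucc) (s.term i.succ) := by
  classical
  simp only [stepLength_eq]
  rw [PolycyclicSeries.infiniteFactors, Nat.card_eq_fintype_card, Fintype.card_subtype,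
    Finset.card_filter]

theorem hasHirsch_of_chain (m : ℕ) (t : Fin (m + 1) → Subgroup G) (h0 : t 0 = ⊥)
    (hs : ∀ i : Fin m, CycStep (t i.castSucc) (t i.succ)) :
    HasHirsch (t (Fin.last m)) (∑ i : Fin m, stepLength (t i.castSucc) (t i.succ)) := by
  induction m with
  | zero =>
    rw [Fin.sum_univ_zero, show Fin.last 0 = 0 from rfl, h0]
    exact .bot
  | succ m ih =>
    rw [Fin.sum_univ_castSucc]
    exact .step (hs (Fin.last m)) (ih (fun i => t i.castSucc) h0 fun i => hs i.castSucc)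

theorem HasHirsch.exists_chain {K : Subgroup G} {k : ℕ} (h : HasHirsch K k) :
    ∃ (m : ℕ) (t : Fin (m + 1) → Subgroup G), t 0 = ⊥ ∧ t (Fin.last m) = K ∧
      (∀ i : Fin m, CycStep (t i.castSucc) (t i.succ)) ∧
      ∑ i : Fin m, stepLength (t i.castSucc) (t i.succ) = k := by
  induction h with
  | bot => exact ⟨0, fun _ => ⊥, rfl, rfl, fun i => i.elim0, rfl⟩
  | @step H K k hHK _ ih =>
    obtain ⟨m, t, h0, hl, hs, hk⟩ := ih
    let t' : Fin (m + 1 + 1) → Subgroup G := Fin.snoc t K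
    have hc : ∀ i : Fin (m + 1), t' i.castSucc = t i := fun i => by simp [t']
    have hlast : t' (Fin.last (m + 1)) = K := by simp [t']
    refine ⟨m + 1, t', ?_, hlast, ?_, ?_⟩
    · rw [← h0]
      exact hc 0
    · intro i
      induction i using Fin.lastCases with
      | last => rw [hc, hl, Fin.succ_last, hlast]; exact hHK
      | cast i => rw [hc, Fin.succ_castSucc, hc]; exact hs i
    · rw [Fin.sum_univ_castSucc, hc, hl, Fin.succ_last, hlast, ← hk]
      congr 1
      refine Finset.sum_congr rfl fun i _ => ?_
      rw [hc, Fin.succ_castSucc, hc]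

theorem hasHirsch_of_series (s : PolycyclicSeries G) :
    HasHirsch (⊤ : Subgroup G) s.infiniteFactors := by
  rw [infiniteFactors_eq, ← s.term_last]
  exact hasHirsch_of_chain s.length s.term s.term_zero fun i =>
    cycStep_iff.2 ⟨s.le_succ i, s.normal i, s.cyclic i⟩

theorem HasHirsch.exists_series {k : ℕ} (h : HasHirsch (⊤ : Subgroup G) k) :
    ∃ s : PolycyclicSeries G, s.infiniteFactors = k := by
  obtain ⟨m, t, h0, hl, hs, hk⟩ := h.exists_chain
  let s : PolycyclicSeries G :=
    { length := m
      term := t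
      term_zero := h0
      term_last := hl
      le_succ := fun i => (hs i).1
      normal := fun i => (hs i).normal
      cyclic := fun i => by have := (hs i).normal; exact (hs i).isCyclic }
  exact ⟨s, (infiniteFactors_eq s).trans hk⟩

theorem isPolycyclic_iff : IsPolycyclic G ↔ ∃ k, HasHirsch (⊤ : Subgroup G) k :=
  ⟨fun ⟨s⟩ => ⟨_, hasHirsch_of_series s⟩, fun ⟨_, h⟩ => ⟨h.exists_series.choose⟩⟩

theorem HasHirsch.hirschLength_eq {k : ℕ} (h : HasHirsch (⊤ : Subgroup G) k) :
    hirschLength G = k := by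
  have : Set.range (fun s : PolycyclicSeries G => s.infiniteFactors) = {k} := by
    ext j
    constructor
    · rintro ⟨s, rfl⟩
      exact (hasHirsch_of_series s).unique h
    · rintro rfl
      exact h.exists_series
  rw [hirschLength, this, csInf_singleton]

theorem exists_hasHirsch_of_commGroup {A : Type*} [CommGroup A] [Group.FG A] :
    ∃ k, HasHirsch (⊤ : Subgroup A) k :=
  exists_hasHirsch_of_fg_central CommGroup.center_eq_top.ge (Group.fg_def.1 inferInstance)

/-- A quotient of the full group with finite kernel has the same Hirsch length. -/
theorem HasHirsch.of_finite_ker {Q : Type*} [Group Q] {f : G →* Q}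
    (hf : Function.Surjective f) (hker : (f.ker : Set G).Finite) {a b : ℕ}
    (ha : HasHirsch (⊤ : Subgroup G) a) (hb : HasHirsch (⊤ : Subgroup Q) b) : a = b := by
  obtain ⟨c, hc⟩ := ha.of_le (le_top (a := f.ker))
  obtain rfl := hc.eq_zero_of_finite hker
  rw [ha.unique (hc.top_of_surjective hf hb), zero_add]

end Polycyclic

/-! ### Size of the tensor square -/

namespace NonabelianTensorSquare

open Polycyclic

variable {G : Type u} [Group G]

/-- Lifts of finitely many generators of `G` generate a subgroup `D` that maps onto `G` and so
contains every commutator of the cover. Its intersection with the central kernel is finitely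
generated, so `D` is polycyclic. -/
theorem CommutatorCover.exists_hasHirsch_emb_range (C : CommutatorCover G)
    (hC : Function.Surjective C.proj) {k : ℕ} (hG : HasHirsch (⊤ : Subgroup G) k) :
    ∃ a, HasHirsch C.emb.range a := by
  obtain ⟨Y, hY⟩ := hG.fg
  let s := Function.surjInv hC
  have hs : ∀ g, C.proj (s g) = g := Function.surjInv_eq hC
  let D := Subgroup.closure (s '' Y)
  have hD : D.FG := (Subgroup.fg_iff _).2 ⟨_, rfl, Y.finite_toSet.image s⟩
  have hmap : D.map C.proj = ⊤ := by
    rw [MonoidHom.map_closure, Set.image_image, Set.image_congr fun y _ => hs y, Set.image_id', hY]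
  have hfg := hG.fg_inf_ker C.ker_proj_le_center D hD hmap
  obtain ⟨a, ha⟩ := exists_hasHirsch_of_fg_central
    (inf_le_right.trans C.ker_proj_le_center) hfg
  have hDh := ha.extension hG hmap.ge
  rw [Subgroup.comap_top, inf_top_eq] at hDh
  refine hDh.of_le ?_
  rintro _ ⟨t, rfl⟩
  induction t using NonabelianTensorSquare.induction with
  | one => simp [one_mem]
  | tmul x y =>
    obtain ⟨a, ha, rfl⟩ : x ∈ D.map C.proj := by rw [hmap]; trivial
    obtain ⟨b, hb, rfl⟩ : y ∈ D.map C.proj := by rw [hmap]; trivial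
    rw [← C.commutator_eq]
    exact mul_mem (mul_mem (mul_mem ha hb) (inv_mem ha)) (inv_mem hb)
  | mul a b ha hb => rw [map_mul]; exact mul_mem ha hb
  | inv a ha => rw [map_inv]; exact inv_mem ha

theorem exists_hasHirsch [Finite (Abelianization G)] [Finite (nabla G)] {k : ℕ}
    (hG : HasHirsch (⊤ : Subgroup G) k) :
    ∃ a, HasHirsch (⊤ : Subgroup (NonabelianTensorSquare G)) a := by
  obtain ⟨C, hC⟩ := CommutatorCover.exists_surjective (G := G)
  obtain ⟨a, ha⟩ := C.exists_hasHirsch_emb_range hC hG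
  obtain ⟨b, hb⟩ := exists_hasHirsch_of_fg_central nabla_le_center
    ((Group.fg_iff_subgroup_fg (nabla G)).1 inferInstance)
  rw [← C.ker_emb, ← top_inf_eq C.emb.ker] at hb
  have := hb.extension ha (by rw [MonoidHom.range_eq_map])
  rw [top_inf_eq, show C.emb.range.comap C.emb = ⊤ by
    rw [eq_top_iff]; exact fun t _ => ⟨t, rfl⟩] at this
  exact ⟨_, this⟩

instance finite_of_finite [Finite G] [Finite (nabla G)] : Finite (NonabelianTensorSquare G) := by
  obtain ⟨C, hC⟩ := CommutatorCover.exists_surjective (G := G)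
  have h1 := C.finite_emb_range hC
  have h2 : Finite C.emb.ker := by rw [C.ker_emb]; infer_instance
  have h3 : Finite (NonabelianTensorSquare G ⧸ C.emb.ker) :=
    Finite.of_equiv _ (QuotientGroup.quotientKerEquivRange C.emb).symm.toEquiv
  exact Finite.of_subgroup_quotient C.emb.ker

theorem card_eq_card_ker_mul_card {H K : Type*} [Group H] [Group K] (f : H →* K)
    (hf : Function.Surjective f) : Nat.card H = Nat.card f.ker * Nat.card K := by
  rw [← Subgroup.card_mul_index f.ker, Subgroup.index_ker, MonoidHom.range_eq_top.2 hf,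
    Subgroup.card_top]

/-- Multiply the orders of the layers of `∇(G) ≤ ker comm ≤ G ⊗ G`. -/
theorem card_eq (hfin : Finite (Abelianization G)) :
    Nat.card (NonabelianTensorSquare G) =
      Nat.card (nabla G) * Nat.card (SchurMultiplier G) * Nat.card (commutator G) := by
  obtain ⟨θ, hθ, hker⟩ := exists_ker_comm_hom G
  have h1 : θ.ker = (nabla G).subgroupOf comm.ker := by
    ext t
    exact hker t
  have h2 := card_eq_card_ker_mul_card θ hθ
  rw [h1, Nat.card_congr (Subgroup.subgroupOfEquivOfLe nabla_le_ker_comm).toEquiv] at h2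
  rw [← h2, ← comm_range, ← Subgroup.index_ker, Subgroup.card_mul_index]

end NonabelianTensorSquare

/-! ### The theorem -/

open Polycyclic NonabelianTensorSquare

theorem theoremt {G : Type u} [Group G] (hG : IsPolycyclic G)
    (p : ℕ) (hp : p.Prime) (hodd : Odd p)
    (n : ℕ) (e : Fin n → ℕ) (he_pos : ∀ i, 1 ≤ e i) (he_mono : Monotone e)
    (hab : Nonempty (Abelianization G ≃* ((i : Fin n) → Multiplicative (ZMod (p ^ e i))))) :
    (Finite G →
      Finite (NonabelianTensorSquare G) ∧ Finite (SchurMultiplier G) ∧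
      Nat.card (NonabelianTensorSquare G) =
        p ^ (∑ i : Fin n, (n - (i.val + 1)) * e i) * Nat.card G * Nat.card (SchurMultiplier G)) ∧
    (Infinite G →
      IsPolycyclic (NonabelianTensorSquare G) ∧ IsPolycyclic (SchurMultiplier G) ∧
      (hirschLength (NonabelianTensorSquare G) : ℤ) - (hirschLength G : ℤ) =
        (hirschLength (SchurMultiplier G) : ℤ)) := by
  obtain ⟨φ⟩ := hab
  have hq0 : ∀ i, p ^ e i ≠ 0 := fun i => pow_ne_zero _ hp.ne_zero
  have hne : ∀ i, NeZero (p ^ e i) := fun i => ⟨hq0 i⟩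
  have hfin : Finite (Abelianization G) := Finite.of_equiv _ φ.symm.toEquiv
  have hnabla := card_nabla hq0 (fun i => hodd.pow) (fun i j h => pow_dvd_pow p (he_mono h)) φ
  have hnfin : Finite (nabla G) := Nat.finite_of_card_ne_zero (by
    rw [hnabla]
    exact Finset.prod_ne_zero_iff.2 fun i _ => pow_ne_zero _ (hq0 i))
  obtain ⟨θ, hθ, hker⟩ := exists_ker_comm_hom G
  have hof : Function.Surjective (Abelianization.of (G := G)) :=
    QuotientGroup.mk'_surjective (commutator G)
  refine ⟨fun hGf => ⟨inferInstance, Finite.of_surjective θ hθ, ?_⟩, fun _ => ?_⟩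
  · have hGcard := card_eq_card_ker_mul_card Abelianization.of hof
    rw [Abelianization.ker_of] at hGcard
    have hab : Nat.card (Abelianization G) = ∏ i : Fin n, p ^ e i := by
      rw [Nat.card_congr φ.toEquiv, Nat.card_pi]
      exact Finset.prod_congr rfl fun i _ => by
        rw [Nat.card_congr Multiplicative.toAdd, Nat.card_zmod]
    have hexp : Nat.card (nabla G) =
        p ^ (∑ i : Fin n, (n - (i.val + 1)) * e i) * Nat.card (Abelianization G) := by
      rw [hnabla, hab, ← Finset.prod_pow_eq_pow_sum, ← Finset.prod_mul_distrib]
      refine Finset.prod_congr rfl fun i _ => ?_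
      rw [← pow_mul, ← pow_add]
      congr 1
      -- For `i` counted from `0`, the exponent `n - i` exceeds the coefficient in `d` by one; these
      -- extra factors multiply to `|G^ab|`.
      have : n - i.val = n - (i.val + 1) + 1 := by have := i.2; omega
      rw [this]
      ring
    rw [card_eq hfin, hexp, hGcard]
    ring
  · obtain ⟨g, hg⟩ := isPolycyclic_iff.1 hG
    obtain ⟨a, ha⟩ := exists_hasHirsch hg
    obtain ⟨j, hj⟩ := ha.of_le (le_top (a := comm.ker))
    obtain ⟨c, hc⟩ := hg.of_le (le_top (a := commutator G))
    have hj' := hasHirsch_top_iff.2 hj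
    have : Group.FG (comm : NonabelianTensorSquare G →* G).ker :=
      (Group.fg_iff_subgroup_fg _).2 hj.fg
    have : Group.FG (SchurMultiplier G) := Group.fg_of_surjective hθ
    obtain ⟨m, hm⟩ := exists_hasHirsch_of_commGroup (A := SchurMultiplier G)
    have hθker : (θ.ker : Set (comm : NonabelianTensorSquare G →* G).ker).Finite := by
      have : Set.InjOn (Subtype.val : (comm : NonabelianTensorSquare G →* G).ker → _)
        (θ.ker : Set _) := Subtype.val_injective.injOn
      refine Set.Finite.of_finite_image ((Set.toFinite (nabla G : Set _)).subset ?_) this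
      rintro _ ⟨t, ht, rfl⟩
      exact (hker t).1 ht
    -- The kernel of `ker comm → M(G)` is the finite group `∇(G)`.
    have hjm : j = m := hj'.of_finite_ker hθ hθker hm
    have hgc : g = c := by
      obtain ⟨z, hz⟩ := exists_hasHirsch_of_commGroup (A := Abelianization G)
      obtain rfl := hz.eq_zero_of_finite (Set.toFinite _)
      rw [← Abelianization.ker_of] at hc
      exact hg.unique (hc.top_of_surjective hof hz)
    have hajc : a = j + c := by
      rw [← comm_range] at hc
      have h1 := HasHirsch.extension (D := ⊤) (by rwa [top_inf_eq]) hc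
        (by rw [MonoidHom.range_eq_map])
      rw [top_inf_eq, show comm.range.comap comm = (⊤ : Subgroup (NonabelianTensorSquare G)) by
        rw [eq_top_iff]; exact fun t _ => ⟨t, rfl⟩] at h1
      exact ha.unique h1
    refine ⟨isPolycyclic_iff.2 ⟨a, ha⟩, isPolycyclic_iff.2 ⟨m, hm⟩, ?_⟩
    rw [ha.hirschLength_eq, hg.hirschLength_eq, hm.hirschLength_eq, hajc, hgc, hjm]
    push_cast
    ring
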